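/- **Conventions.** A plumbing is a finite tree $\Gamma$ with integer vertex weights; $B$ is its adjacency matrix (weights on the diagonal, $1$ for every edge), $\pi(\Gamma)$ the number of positive eigenvalues of $B$, and $H_1(Y(\Gamma))=\mathbb Z^s/B\mathbb Z^s$. For $d\in\mathbb Z$, the expansion of $\left(\frac{y-z}{(1-y)(1-z)}\right)^d$ in the chamber $\alpha_+$ is in powers of $y,z^{-1}$, and in the chamber $\alpha_-$ in powers of $y^{-1},z$. For a closed plumbed manifold $Y=Y(\Gamma)$ with $B$ invertible, and $\vec b,\vec c\in\mathbb Z^s$, $$\hat Z^{(\alpha_\pm)}_{\vec b,\vec c}[Y;q]=(-1)^{\pi(\Gamma)}\sum_{\vec l_1\in B\mathbb Z^s+\vec b,\ \vec l_2\in B\mathbb Z^s+\vec c} q^{(\vec l_1,B^{-1}\vec l_2)}\ \mathrm{CT}\prod_{v}\left(\tfrac{y_v-z_v}{(1-y_v)(1-z_v)}\right)^{2-\deg v}\Big|_{\alpha_\pm}y_v^{l_{1,v}}z_v^{l_{2,v}},$$ where $\mathrm{CT}$ is the constant term in all variables. A sign vector $(\alpha_v)_v$, $\alpha_v=\pm1$,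 is a good chamber if $-B^{-1}_{ij}\alpha_i\alpha_j$ is strictly copositive on the vertices of degree $>2$, $B^{-1}_{ij}\alpha_i\alpha_j\le 0$ whenever $\deg i=1$, $\deg j\neq 2$, and $B^{-1}_{ij}\alpha_i\alpha_j<0$ whenever $\deg i=\deg j=1$, $i\ne j$. A plumbed knot $K$ is a plumbing $\Gamma_K$ with a distinguished vertex $v_*$; deleting $v_*$ gives a plumbing of the ambient manifold. Put $y=y_{v_*}$, $z=z_{v_*}$. For integers $n,m$, $$F_K^{(\alpha_\pm)}(y,z,q)=(-1)^{\pi(\Gamma_K)}\left(\tfrac{y-z}{(1-y)(1-z)}\right)^{1-\deg v_*}\Big|_{\alpha_\pm}\sum_{\vec n,\vec m} q^{(\vec n,B\vec m)}\,y^{(B\vec n)_{v_*}}z^{(B\vec m)_{v_*}}\ \mathrm{CT}\prod_{v\ne v_*}\left(\tfrac{y_v-z_v}{(1-y_v)(1-z_v)}\right)^{2-\deg v}\Big|_{\alpha_\pm}y_v^{(B\vec n)_v}z_v^{(B\vec m)_v},$$ the sum being over integer vectors with $n_{v_*}=n$, $m_{v_*}=m$. **Theorem.** Let $K$ be a plumbed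 knot in $S^3$ or, more generally, in a plumbed integral homology sphere (the adjacency matrix of $\Gamma_K\setminus v_*$ has determinant $\pm1$), with $v_*$ carrying the Seifert framing ($\det B_{\Gamma_K}=0$). Let $p,r$ be coprime nonzero integers, and let the solid torus $S_{p/r}$ be given by a linear plumbing with weights $k_1,\dots,k_s$, $p/r=k_1-\cfrac{1}{k_2-\cdots-\frac1{k_s}}$, with its first vertex distinguished. Let $Y_{p/r}$ be the plumbed manifold whose graph is obtained from these two graphs by identifying the distinguished vertices and adding their weights, and assume that this plumbing is negative definite. Then: 1. The sign vectors $\alpha_+=(1,\dots,1)$ and $\alpha_-=(-1,\dots,-1)$ are good chambers of $Y_{p/r}$, and every good chamber agrees with one of them on the vertices of degree $\neq2$. 2. For $\vec x\in\mathbb Z^V$ (where $V$ is the vertex set of the graph of $Y_{p/r}$, and $B$ its matrix), $p\,(B^{-1}\vec x)_{v_*}$ is an integer, and $\vec x\mapsto p\,(B^{-1}\vec x)_{v_*}$ induces a bijection $H_1(Y_{p/r})\cong\mathbb Z/p$. 3. Let $\pm$ be either chamber and $n,m\in\mathbb Z$. Each coefficient of a monomial $y^\alpha z^\beta$ in $F_K^{(\alpha_\pm)}$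 is a finite sum. Let $\vec b,\vec c\in\mathbb Z^V$ and write $b=p(B^{-1}\vec b)_{v_*}$, $c=p(B^{-1}\vec c)_{v_*}$. Then $$\hat Z^{(\alpha_\pm)}_{\vec b,\vec c}[Y_{p/r};q]=(-1)^{\tau}\,\mathcal L^{(\alpha_\pm;\,p/r)}_{b,c}\left[F_K^{(\alpha_\pm)}(y,z,q)\right],\qquad \tau=\pi(Y_{p/r})-\pi(\Gamma_K)-\pi(S_{p/r}),$$ where $\mathcal L$ is extended linearly from $$\mathcal L^{(\alpha_+;p/r)}_{b,c}:\ y^\alpha z^\beta q^\gamma\mapsto q^\gamma\Bigg(\sum_{\substack{s\ge1\\ r\alpha+\epsilon s+b\in p\mathbb Z\\ r\beta+c\in p\mathbb Z}}q^{\frac{\beta(r\alpha+\epsilon s)}p}+\sum_{\substack{s\ge0\\ r\beta-\epsilon s+c\in p\mathbb Z\\ r\alpha+b\in p\mathbb Z}}q^{\frac{\alpha(r\beta-\epsilon s)}p}\Bigg),$$ $$\mathcal L^{(\alpha_-;p/r)}_{b,c}:\ y^\alpha z^\beta q^\gamma\mapsto -q^\gamma\Bigg(\sum_{\substack{s\ge0\\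 r\alpha-\epsilon s+b\in p\mathbb Z\\ r\beta+c\in p\mathbb Z}}q^{\frac{\beta(r\alpha-\epsilon s)}p}+\sum_{\substack{s\ge1\\ r\beta+\epsilon s+c\in p\mathbb Z\\ r\alpha+b\in p\mathbb Z}}q^{\frac{\alpha(r\beta+\epsilon s)}p}\Bigg),$$ and $\epsilon=\mathrm{sign}(p)(-1)^{\pi(S_{p/r})+1}$. The equality is an equality of formal series in rational powers of $q$; on each side, for every $E\in\mathbb Q$ only finitely many terms have nonzero exponent $\le E$. If $p\mid b$ or $p\mid c$, the equality is understood up to the constant term (the coefficient of $q^0$, a divergent sum). If $p\nmid b$ and $p\nmid c$, it holds for all coefficients, and the finiteness includes the exponent $0$. -/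

import Mathlib

open scoped Matrix

noncomputable section

/-- A weighted graph. Trees are singled out by the hypothesis `graph.IsTree`. -/
structure PlumbingGraph (V : Type*) where
  graph : SimpleGraph V
  weight : V → ℤ

namespace PlumbingGraph

/-- The degree of a vertex. -/
def deg {V : Type*} (Γ : PlumbingGraph V) (v : V) : ℕ := (Γ.graph.neighborSet v).ncard

open Classical in
/-- The adjacency (linking) matrix `B`: weights on the diagonal, `1` for every edge. -/
def B {V : Type*} (Γ : PlumbingGraph V) : Matrix V V ℤ :=
  Matrix.of fun i j => if i = j then Γ.weight i else if Γ.graph.Adj i j then 1 else 0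

/-- `B` with rational entries. -/
def Bq {V : Type*} (Γ : PlumbingGraph V) : Matrix V V ℚ := Γ.B.map (fun x : ℤ => (x : ℚ))

/-- `B` with real entries. -/
def Br {V : Type*} (Γ : PlumbingGraph V) : Matrix V V ℝ := Γ.B.map (fun x : ℤ => (x : ℝ))

/-- The plumbing is negative definite. -/
def IsNegDef {V : Type*} (Γ : PlumbingGraph V) : Prop := (-Γ.Br).PosDef

/-- The number `π` of positive eigenvalues of `B`, with multiplicity. -/
def numPos {V : Type*} [Fintype V] [DecidableEq V] (Γ : PlumbingGraph V) : ℕ :=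
  (Γ.Br.charpoly.roots.filter (fun x => 0 < x)).card

/-- The adjacency matrix of the graph in which the distinguished vertex `v` and its edges are
removed: a plumbing of the ambient closed manifold that contains the knot. -/
def ambientB {V : Type*} (Γ : PlumbingGraph V) (v : V) : Matrix {w : V // w ≠ v} {w : V // w ≠ v} ℤ :=
  Γ.B.submatrix Subtype.val Subtype.val

/-- Gluing of two plumbed manifolds with torus boundary: the distinguished vertices `v₁` and `v₂`
are identified and their weights are added. The glued vertex is `Sum.inl v₁`. -/
def glue {V W : Type*} [DecidableEq V] (Γ₁ : PlumbingGraph V) (v₁ : V)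
    (Γ₂ : PlumbingGraph W) (v₂ : W) : PlumbingGraph (V ⊕ {w : W // w ≠ v₂}) where
  graph :=
    { Adj := fun a b => match a, b with
        | Sum.inl x, Sum.inl y => Γ₁.graph.Adj x y
        | Sum.inr x, Sum.inr y => Γ₂.graph.Adj x y
        | Sum.inl x, Sum.inr y => x = v₁ ∧ Γ₂.graph.Adj v₂ y
        | Sum.inr x, Sum.inl y => y = v₁ ∧ Γ₂.graph.Adj v₂ x
      symm := ⟨by
        rintro (x | x) (y | y) h
        · exact Γ₁.graph.adj_symm h
        · exact h
        · exact h
        · exact Γ₂.graph.adj_symm h⟩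
      loopless := ⟨by
        rintro (x | x) h
        · exact Γ₁.graph.loopless.irrefl x h
        · exact Γ₂.graph.loopless.irrefl _ h⟩ }
  weight := fun a => match a with
    | Sum.inl x => Γ₁.weight x + if x = v₁ then Γ₂.weight v₂ else 0
    | Sum.inr y => Γ₂.weight y

/-- The linear graph with weights `k 0, …, k ℓ`. With distinguished vertex `0` it is the plumbing
of the solid torus. -/
def chain {ℓ : ℕ} (k : Fin (ℓ + 1) → ℤ) : PlumbingGraph (Fin (ℓ + 1)) where
  graph := SimpleGraph.pathGraph (ℓ + 1)
  weight := k

/-- A choice of signs `α` is a good chamber: `X i j = -(B⁻¹) i j * α i * α j` is (strictly)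
copositive on the vertices of degree `> 2`, and the two sign conditions on the vertices of degree
`1` hold. -/
def IsGoodChamber {V : Type*} [Fintype V] [DecidableEq V] (Γ : PlumbingGraph V)
    (α : V → ℤˣ) : Prop :=
  (∀ x : V → ℝ, (∀ i, 0 ≤ x i) → (∀ i, x i ≠ 0 → 2 < Γ.deg i) → x ≠ 0 →
      0 < ∑ i, ∑ j, (-(Γ.Br⁻¹ i j) * (((α i : ℤˣ) : ℤ) : ℝ) * (((α j : ℤˣ) : ℤ) : ℝ)) * x i * x j) ∧
  (∀ i j, Γ.deg i = 1 → Γ.deg j ≠ 2 →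
      Γ.Br⁻¹ i j * (((α i : ℤˣ) : ℤ) : ℝ) * (((α j : ℤˣ) : ℤ) : ℝ) ≤ 0) ∧
  (∀ i j, Γ.deg i = 1 → Γ.deg j = 1 → i ≠ j →
      Γ.Br⁻¹ i j * (((α i : ℤˣ) : ℤ) : ℝ) * (((α j : ℤˣ) : ℤ) : ℝ) < 0)

end PlumbingGraph

/-- The continued fraction `k₁ - 1/(k₂ - 1/(⋯ - 1/kₛ))`. -/
def contFrac : List ℤ → ℚ
  | [] => 0
  | k :: ks => (k : ℚ) - (contFrac ks)⁻¹

/-- A power series over `ℤ` with constant term `1`, as a unit. -/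
def seriesUnit (φ : MvPowerSeries (Fin 2) ℤ) (h : MvPowerSeries.constantCoeff φ = 1) :
    (MvPowerSeries (Fin 2) ℤ)ˣ :=
  ⟨φ, MvPowerSeries.invOfUnit φ 1, MvPowerSeries.mul_invOfUnit φ 1 h,
    MvPowerSeries.invOfUnit_mul φ 1 h⟩

/-- The power series `(1 - u x) / ((1 - u) (1 - x))` in `u = X 0`, `x = X 1`, as a unit of
`ℤ⟦u, x⟧`. -/
def edgeUnit : (MvPowerSeries (Fin 2) ℤ)ˣ :=
  seriesUnit (1 - MvPowerSeries.X 0 * MvPowerSeries.X 1) (by simp) *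
    (seriesUnit ((1 - MvPowerSeries.X 0) * (1 - MvPowerSeries.X 1)) (by simp))⁻¹

/-- The coefficient of `y ^ i * z ^ j` in the expansion of `((y - z) / ((1 - y) (1 - z))) ^ d` in
the chamber `σ = ±1`. For `σ = 1` the expansion is in `u = y`, `x = z⁻¹`, where the rational
function is `(1 - u x) / ((1 - u) (1 - x))`; for `σ = -1` it is in `u = y⁻¹`, `x = z`, where it is
`-(1 - u x) / ((1 - u) (1 - x))`. For `d = 1` these are
`1 + ∑ yʳ + ∑ z⁻ʳ` and `-1 - ∑ y⁻ʳ - ∑ zʳ` (`r ≥ 1`); for `d < 0` they are the expansions in powers of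
`y / z` and `z / y`. -/
def edgeCoeff (σ : ℤˣ) (d i j : ℤ) : ℤ :=
  if 0 ≤ (σ : ℤ) * i ∧ (σ : ℤ) * j ≤ 0 then
    ((σ ^ d : ℤˣ) : ℤ) *
      MvPowerSeries.coeff
        (Finsupp.single (0 : Fin 2) ((σ : ℤ) * i).toNat +
          Finsupp.single (1 : Fin 2) (-((σ : ℤ) * j)).toNat)
        ((edgeUnit ^ d : (MvPowerSeries (Fin 2) ℤ)ˣ) : MvPowerSeries (Fin 2) ℤ)
  else 0

namespace PlumbingGraph

/-! ### The series of a closed plumbed manifold -/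

/-- The pairs `(l₁, l₂)` with `l₁ ∈ B ℤˢ + b` and `l₂ ∈ B ℤˢ + c`. -/
def latticePairs {V : Type*} [Fintype V] (Γ : PlumbingGraph V) (b c : V → ℤ) :
    Set ((V → ℤ) × (V → ℤ)) :=
  {l | (∃ n : V → ℤ, l.1 = Γ.B *ᵥ n + b) ∧ (∃ m : V → ℤ, l.2 = Γ.B *ᵥ m + c)}

/-- The exponent `(l₁, B⁻¹ l₂)` of `q`. -/
def qExponent {V : Type*} [Fintype V] [DecidableEq V] (Γ : PlumbingGraph V)
    (l : (V → ℤ) × (V → ℤ)) : ℚ :=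
  (fun v => (l.1 v : ℚ)) ⬝ᵥ (Γ.Bq⁻¹ *ᵥ fun v => (l.2 v : ℚ))

/-- `(-1)^π` times the constant term in all variables `y_v, z_v` of
`∏ ((y_v - z_v) / ((1 - y_v) (1 - z_v))) ^ (2 - deg v)`, expanded in the chamber `α`, times
`∏ y_v ^ (l₁ v) * z_v ^ (l₂ v)`. -/
def closedTerm {V : Type*} [Fintype V] [DecidableEq V] (Γ : PlumbingGraph V) (α : V → ℤˣ)
    (l : (V → ℤ) × (V → ℤ)) : ℤ :=
  (-1) ^ Γ.numPos * ∏ v, edgeCoeff (α v) (2 - (Γ.deg v : ℤ)) (-(l.1 v)) (-(l.2 v))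

/-- The indices of the nonzero terms of the sum that defines `Ẑ_{b,c}`. -/
def zhatSupport {V : Type*} [Fintype V] [DecidableEq V] (Γ : PlumbingGraph V) (α : V → ℤˣ)
    (b c : V → ℤ) : Set ((V → ℤ) × (V → ℤ)) :=
  {l | l ∈ Γ.latticePairs b c ∧ Γ.closedTerm α l ≠ 0}

/-- The coefficient of `q ^ e` in `Ẑ_{b,c}`, computed in the chamber `α`. -/
def zhatCoeff {V : Type*} [Fintype V] [DecidableEq V] (Γ : PlumbingGraph V) (α : V → ℤˣ)
    (b c : V → ℤ) (e : ℚ) : ℤ :=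
  ∑ᶠ l ∈ {l | l ∈ Γ.zhatSupport α b c ∧ Γ.qExponent l = e}, Γ.closedTerm α l

/-! ### The three variable series of a plumbed knot complement -/

/-- The contribution of the lattice vectors `x = (n⃗, m⃗)` (that is, `l₁ = B n⃗` and `l₂ = B m⃗`) to the
coefficient of `y ^ i * z ^ j` in the series of the knot complement with label `(0, 0)`. The variables
of all vertices but the distinguished vertex `v` are integrated out; the factor of `v` has exponent
`1 - deg v` and is kept. -/
def knotTerm {V : Type*} [Fintype V] [DecidableEq V] (Γ : PlumbingGraph V) (v : V) (α : V → ℤˣ)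
    (i j : ℤ) (x : (V → ℤ) × (V → ℤ)) : ℤ :=
  (-1) ^ Γ.numPos *
    edgeCoeff (α v) (1 - (Γ.deg v : ℤ)) (i - (Γ.B *ᵥ x.1) v) (j - (Γ.B *ᵥ x.2) v) *
    ∏ w ∈ Finset.univ.erase v,
      edgeCoeff (α w) (2 - (Γ.deg w : ℤ)) (-((Γ.B *ᵥ x.1) w)) (-((Γ.B *ᵥ x.2) w))

/-- The indices of the nonzero terms that contribute to `y ^ i * z ^ j`: pairs of lattice vectors
whose components at the distinguished vertex are the given integers `n` and `m`. -/
def knotSupport {V : Type*} [Fintype V] [DecidableEq V] (Γ : PlumbingGraph V) (v : V) (α : V → ℤˣ)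
    (n m i j : ℤ) : Set ((V → ℤ) × (V → ℤ)) :=
  {x | x.1 v = n ∧ x.2 v = m ∧ Γ.knotTerm v α i j x ≠ 0}

/-- The coefficient of `y ^ i * z ^ j * q ^ γ` in `F_K (y, z, q; α) = Ẑ_{0,0} (Y_K; y, z, n, m, q; α)`.
The exponent of `q` is `(n⃗, B m⃗)`, which is `(l₁, B⁻¹ l₂)` when `B` is invertible and makes sense
also for the degenerate `B` of a `0`-framed knot. -/
def knotCoeff {V : Type*} [Fintype V] [DecidableEq V] (Γ : PlumbingGraph V) (v : V) (α : V → ℤˣ)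
    (n m i j γ : ℤ) : ℤ :=
  ∑ᶠ x ∈ {x | x ∈ Γ.knotSupport v α n m i j ∧ x.1 ⬝ᵥ (Γ.B *ᵥ x.2) = γ}, Γ.knotTerm v α i j x

end PlumbingGraph

/-! ### The Laplace transform

The image of `y ^ α * z ^ β * q ^ γ` under the transform in the chamber `σ` is
`σ q ^ γ` times the sum of two series: one over the shifts `s` of the exponent of `y` (index `Sum.inl s`)
and one over the shifts `s` of the exponent of `z` (index `Sum.inr s`). Each runs over all `s` that
satisfy its congruence conditions; `s` starts at `1` in one and at `0` in the other. -/

/-- The range of summation and the congruence conditions. -/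
def laplaceAdmissible (σ : ℤˣ) (p r ε b c α β : ℤ) : ℕ ⊕ ℕ → Prop
  | Sum.inl s => (if σ = 1 then 1 else 0) ≤ s ∧ p ∣ r * α + σ * ε * s + b ∧ p ∣ r * β + c
  | Sum.inr s => (if σ = 1 then 0 else 1) ≤ s ∧ p ∣ r * β - σ * ε * s + c ∧ p ∣ r * α + b

/-- The exponent of `q`. -/
def laplaceExponent (σ : ℤˣ) (p r ε α β γ : ℤ) : ℕ ⊕ ℕ → ℚ
  | Sum.inl s => γ + ((β * (r * α + σ * ε * s) : ℤ) : ℚ) / p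
  | Sum.inr s => γ + ((α * (r * β - σ * ε * s) : ℤ) : ℚ) / p

/-- The indices `(α, β, γ, s)` of the nonzero terms of the transform of
`∑ F α β γ * y ^ α * z ^ β * q ^ γ`. -/
def laplaceSupport (σ : ℤˣ) (p r ε b c : ℤ) (F : ℤ → ℤ → ℤ → ℤ) : Set (ℤ × ℤ × ℤ × (ℕ ⊕ ℕ)) :=
  {x | F x.1 x.2.1 x.2.2.1 ≠ 0 ∧ laplaceAdmissible σ p r ε b c x.1 x.2.1 x.2.2.2}

/-- The coefficient of `q ^ e` in the transform of `∑ F α β γ * y ^ α * z ^ β * q ^ γ`. -/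
def laplaceCoeff (σ : ℤˣ) (p r ε b c : ℤ) (F : ℤ → ℤ → ℤ → ℤ) (e : ℚ) : ℤ :=
  ∑ᶠ x ∈ {x : ℤ × ℤ × ℤ × (ℕ ⊕ ℕ) | x ∈ laplaceSupport σ p r ε b c F ∧
    laplaceExponent σ p r ε x.1 x.2.1 x.2.2.1 x.2.2.2 = e}, (σ : ℤ) * F x.1 x.2.1 x.2.2.1

/-- `ε = sign(p) (-1)^(π + 1)`, where `π` belongs to the plumbing of the solid torus. -/
def surgerySign {ℓ : ℕ} (p : ℤ) (k : Fin (ℓ + 1) → ℤ) : ℤ :=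
  p.sign * (-1) ^ ((PlumbingGraph.chain k).numPos + 1)

/-- The plumbing of the surgered manifold: the plumbing of the knot complement glued to that of the
solid torus. -/
def surgeryGraph {V : Type*} [DecidableEq V] (Γ : PlumbingGraph V) (v : V) {ℓ : ℕ}
    (k : Fin (ℓ + 1) → ℤ) : PlumbingGraph (V ⊕ {i : Fin (ℓ + 1) // i ≠ 0}) :=
  Γ.glue v (PlumbingGraph.chain k) 0

/-- `τ = π(Y_{p/r}) - π(Y_K) - π(solid torus)`. -/
def surgeryTau {V : Type*} [Fintype V] [DecidableEq V] (Γ : PlumbingGraph V) (v : V) {ℓ : ℕ}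
    (k : Fin (ℓ + 1) → ℤ) : ℤ :=
  ((surgeryGraph Γ v k).numPos : ℤ) - (Γ.numPos : ℤ) - ((PlumbingGraph.chain k).numPos : ℤ)

/-- The integer `a` is the label of (the class in `H₁ = ℤˢ / B ℤˢ` of) the vector `x`: it is `p` times
the entry of `B⁻¹ x` at the glued vertex. -/
def IsLabel {V : Type*} [Fintype V] [DecidableEq V] (Γ : PlumbingGraph V) (v : V) {ℓ : ℕ}
    (k : Fin (ℓ + 1) → ℤ) (p : ℤ) (x : V ⊕ {i : Fin (ℓ + 1) // i ≠ 0} → ℤ) (a : ℤ) : Prop :=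
  (a : ℚ) = p * ((surgeryGraph Γ v k).Bq⁻¹ *ᵥ fun w => (x w : ℚ)) (Sum.inl v)

end

/-!
Both sides of the surgery formula are sums over one family of contributions, of which finitely many
have a given exponent of `q` (other than the exceptional exponent `0`). The
finiteness comes from positivity of matrix entries.

*Positivity.* The linking matrix `B` of the surgered manifold is negative definite, its off-diagonal
entries are nonnegative, and its graph is connected. Hence all entries of `B⁻¹` are negative
(`Matrix.PosDef.inv_pos_of_preconnected`). This decides the good chambers at once. It also shows that
on the cone that supports the expansion in the chamber `σ`, the exponent `(l₁, B⁻¹ l₂)` is a sum of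
nonnegative terms, in which every product `|l₁ i| * |l₂ j|` enters with a positive factor. So it
vanishes only if `l₁ = 0` or `l₂ = 0`, and each bound on a nonzero exponent leaves finitely many
vectors (`PlumbingGraph.IsNegDef.finite_qExponent_le`).

*Linear algebra of the gluing.* Since the ambient manifold is an integral homology sphere and the
framing is zero, the linking matrix of the knot has an integral kernel vector `e` with entry `1` at the
distinguished vertex. A multiple of `e`, continued along the linear plumbing by the recursion that
also computes the continued fraction, is an integral vector `h` that `B` maps to a multiple `c` of the
basis vector of the glued vertex (`SurgeryData`, `exists_surgeryData`). By positivity `h > 0 > c`, and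
up to a common sign `ε` the pair `(c, h v)` is `(p, r)`. The label of `x` is `ε (h, x)`, and divisibility
of `(h, x)` by `c` characterizes the image of `B` (`SurgeryData.exists_mulVec_iff`). All three numbers
`π` vanish, so `τ = 0` and the sign of the surgery is `ε`.

*Rearrangement.* An index consists of the exponents of the two knot variables, two lattice vectors of
the knot plumbing with fixed entries at the distinguished vertex, and a shift `s`, that is, a monomial
of `(y - z) / ((1 - y) (1 - z))`. The shift comes from the last vertex of the linear plumbing; if the
latter is a single vertex, it comes from splitting off one factor at the glued vertex
(`edgeCoeff_add_one`). Each index maps to a pair of vectors `(l₁, l₂)` of the surgered manifold, and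
summation over the fibres gives its terms (`SurgeryData.closedTerm_eq_finsum`). Each index also maps to a
term of the Laplace transform, and there the fibre sums are the coefficients of the knot series. The
two maps transport the exponents and the congruences into each other
(`SurgeryData.qExponent_surgeryPair`, `SurgeryData.surgeryPair_mem_latticePairs_iff`).
-/

section

/-! ### Expansions at a vertex -/

open MvPowerSeries in
/-- The expansion of `(1 - u x) / ((1 - u) (1 - x))`. -/
theorem coeff_edgeUnit (n : Fin 2 →₀ ℕ) :
    coeff n (edgeUnit : MvPowerSeries (Fin 2) ℤ) = if n 0 = 0 ∨ n 1 = 0 then 1 else 0 := by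
  set G : MvPowerSeries (Fin 2) ℤ := fun n => if n 0 = 0 ∨ n 1 = 0 then 1 else 0 with hG
  have hGc : ∀ n, coeff n G = if n 0 = 0 ∨ n 1 = 0 then 1 else 0 := fun n => rfl
  have hX : ∀ (i : Fin 2) (ψ : MvPowerSeries (Fin 2) ℤ) (n : Fin 2 →₀ ℕ),
      coeff n (X i * ψ) = if 1 ≤ n i then coeff (n - Finsupp.single i 1) ψ else 0 := by
    intro i ψ n
    classical
    rw [X_def, coeff_monomial_mul]
    simp [Finsupp.single_le_iff]
  have key : ((1 - X 0) * (1 - X 1)) * G = (1 - X 0 * X 1 : MvPowerSeries (Fin 2) ℤ) := by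
    have e1 : ((1 - X 0) * (1 - X 1)) * G = G - X 0 * G - X 1 * G + X 0 * (X 1 * G) := by ring
    have e2 : (1 - X 0 * X 1 : MvPowerSeries (Fin 2) ℤ) = 1 - X 0 * (X 1 * 1) := by ring
    rw [e1, e2]
    ext n
    have hz : n = 0 ↔ n 0 = 0 ∧ n 1 = 0 := by
      constructor
      · rintro rfl; simp
      · rintro ⟨h0, h1⟩; ext i; fin_cases i <;> simpa
    have hz' : n - Finsupp.single 0 1 - Finsupp.single 1 1 = 0 ↔ n 0 ≤ 1 ∧ n 1 ≤ 1 := by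
      constructor
      · intro h
        have a := DFunLike.congr_fun h 0
        have b := DFunLike.congr_fun h 1
        simp at a b
        omega
      · rintro ⟨h0, h1⟩; ext i; fin_cases i <;> simp <;> omega
    simp only [map_sub, map_add, hX, hGc, coeff_one, hz, hz']
    simp only [Finsupp.coe_tsub, Pi.sub_apply, Finsupp.single_apply]
    simp
    generalize n 0 = a
    generalize n 1 = b
    rcases a with _ | _ | a <;> rcases b with _ | _ | b <;> simp
  have hu : (edgeUnit : MvPowerSeries (Fin 2) ℤ) = G := by
    have h2 : (edgeUnit : MvPowerSeries (Fin 2) ℤ) * ((1 - X 0) * (1 - X 1)) = 1 - X 0 * X 1 := by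
      have h3 : edgeUnit * seriesUnit ((1 - X 0) * (1 - X 1)) (by simp) =
          seriesUnit (1 - X 0 * X 1) (by simp) := by simp [edgeUnit]
      exact congrArg Units.val h3
    have h4 : IsUnit ((1 - X 0) * (1 - X 1) : MvPowerSeries (Fin 2) ℤ) :=
      ⟨seriesUnit ((1 - X 0) * (1 - X 1)) (by simp), rfl⟩
    exact h4.mul_left_injective (by simp only [h2]; rw [mul_comm G, key])
  rw [hu, hGc]

/-- The range of the shift `s` in the two series of the Laplace transform. -/
def ShiftAdmissible (σ : ℤˣ) : ℕ ⊕ ℕ → Prop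
  | Sum.inl s => (if σ = 1 then 1 else 0) ≤ s
  | Sum.inr s => (if σ = 1 then 0 else 1) ≤ s

/-- The exponent of `y` in the monomial of `(y - z) / ((1 - y) (1 - z))` that belongs to a shift. -/
def yShift (σ : ℤˣ) : ℕ ⊕ ℕ → ℤ
  | Sum.inl s => σ * s
  | Sum.inr _ => 0

/-- The exponent of `z` in the monomial of `(y - z) / ((1 - y) (1 - z))` that belongs to a shift. -/
def zShift (σ : ℤˣ) : ℕ ⊕ ℕ → ℤ
  | Sum.inl _ => 0
  | Sum.inr s => -(σ * s)

/-- The exponent vector in `u, x` that belongs to a shift. -/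
noncomputable def shiftExp : ℕ ⊕ ℕ → Fin 2 →₀ ℕ
  | Sum.inl s => Finsupp.single 0 s
  | Sum.inr s => Finsupp.single 1 s

theorem units_mul_self (σ : ℤˣ) : (σ : ℤ) * σ = 1 := by
  rcases Int.units_eq_one_or σ with rfl | rfl <;> rfl

theorem shiftExp_injOn (σ : ℤˣ) : Set.InjOn shiftExp {s | ShiftAdmissible σ s} := by
  rintro (s | s) hs (t | t) ht h
  · have := DFunLike.congr_fun h 0
    simpa [shiftExp] using this
  · have h0 := DFunLike.congr_fun h 0
    have h1 := DFunLike.congr_fun h 1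
    simp [shiftExp] at h0 h1
    subst h0 h1
    simp only [ShiftAdmissible, Set.mem_ofPred_eq] at hs ht
    split_ifs at hs ht <;> omega
  · have h0 := DFunLike.congr_fun h 0
    have h1 := DFunLike.congr_fun h 1
    simp [shiftExp] at h0 h1
    subst h0 h1
    simp only [ShiftAdmissible, Set.mem_ofPred_eq] at hs ht
    split_ifs at hs ht <;> omega
  · have := DFunLike.congr_fun h 1
    simpa [shiftExp] using this

theorem exists_shiftExp_eq (σ : ℤˣ) (n : Fin 2 →₀ ℕ) (h : n 0 = 0 ∨ n 1 = 0) :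
    ∃ s, ShiftAdmissible σ s ∧ shiftExp s = n := by
  have hl : n 1 = 0 → shiftExp (Sum.inl (n 0)) = n := fun h1 => by
    ext i; fin_cases i <;> simp [shiftExp, h1]
  have hr : n 0 = 0 → shiftExp (Sum.inr (n 1)) = n := fun h0 => by
    ext i; fin_cases i <;> simp [shiftExp, h0]
  by_cases h0 : n 0 = 0 <;> by_cases h1 : n 1 = 0
  · by_cases hσ : σ = 1
    · exact ⟨_, by simp [ShiftAdmissible, hσ], hr h0⟩
    · exact ⟨_, by simp [ShiftAdmissible, hσ], hl h1⟩
  · exact ⟨_, by simp only [ShiftAdmissible]; split_ifs <;> omega, hr h0⟩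
  · exact ⟨_, by simp only [ShiftAdmissible]; split_ifs <;> omega, hl h1⟩
  · simp_all

open MvPowerSeries in
/-- Multiplication by `(1 - u x) / ((1 - u) (1 - x))` on coefficients. -/
theorem coeff_mul_edgeUnit (σ : ℤˣ) (ψ : MvPowerSeries (Fin 2) ℤ) (n : Fin 2 →₀ ℕ) :
    coeff n (ψ * (edgeUnit : MvPowerSeries (Fin 2) ℤ)) =
      ∑ᶠ s ∈ {s | ShiftAdmissible σ s ∧ shiftExp s ≤ n}, coeff (n - shiftExp s) ψ := by
  classical
  rw [coeff_mul]
  simp only [coeff_edgeUnit, mul_ite, mul_one, mul_zero]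
  rw [← Finset.sum_filter, ← finsum_mem_coe_finset]
  symm
  refine finsum_mem_eq_of_bijOn (fun s => (n - shiftExp s, shiftExp s)) ⟨?_, ?_, ?_⟩ ?_
  · rintro s ⟨hs, hle⟩
    simp only [Finset.coe_filter, Set.mem_ofPred_eq, Finset.HasAntidiagonal.mem_antidiagonal]
    refine ⟨tsub_add_cancel_of_le hle, ?_⟩
    rcases s with s | s <;> simp [shiftExp]
  · rintro s ⟨hs, _⟩ t ⟨ht, _⟩ h
    exact shiftExp_injOn σ hs ht (Prod.ext_iff.1 h).2
  · rintro ⟨a, b⟩ hab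
    simp only [Finset.coe_filter, Set.mem_ofPred_eq, Finset.HasAntidiagonal.mem_antidiagonal] at hab
    obtain ⟨s, hs, rfl⟩ := exists_shiftExp_eq σ b hab.2
    refine ⟨s, ⟨hs, ?_⟩, ?_⟩
    · exact hab.1 ▸ le_add_self
    · simp [← hab.1]
  · intro s _
    rfl

theorem edgeCoeff_sign {σ : ℤˣ} {d i j : ℤ} (h : edgeCoeff σ d i j ≠ 0) :
    0 ≤ (σ : ℤ) * i ∧ (σ : ℤ) * j ≤ 0 := by
  by_contra h'
  exact h (by rw [edgeCoeff, if_neg h'])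

theorem edgeCoeff_zero (σ : ℤˣ) (i j : ℤ) :
    edgeCoeff σ 0 i j = if i = 0 ∧ j = 0 then 1 else 0 := by
  classical
  by_cases h : i = 0 ∧ j = 0
  · obtain ⟨rfl, rfl⟩ := h
    simp [edgeCoeff]
  · rw [if_neg h]
    by_contra h'
    have hs := edgeCoeff_sign h'
    rw [edgeCoeff, if_pos hs] at h'
    simp only [zpow_zero, Units.val_one, one_mul, MvPowerSeries.coeff_one] at h'
    have h2 := (ite_ne_right_iff.1 h').1
    have a := DFunLike.congr_fun h2 0
    have b := DFunLike.congr_fun h2 1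
    simp at a b
    rcases Int.units_eq_one_or σ with rfl | rfl <;> simp at a b hs <;> omega

/-- Multiplication by `(y - z) / ((1 - y) (1 - z))` on coefficients, in the chamber `σ`. -/
theorem edgeCoeff_add_one (σ : ℤˣ) (d i j : ℤ) :
    edgeCoeff σ (d + 1) i j =
      ∑ᶠ s ∈ {s | ShiftAdmissible σ s},
        (σ : ℤ) * edgeCoeff σ d (i - yShift σ s) (j - zShift σ s) := by
  have hσ := units_mul_self σ
  have ha : ∀ s, (σ : ℤ) * (i - yShift σ s) = σ * i - (shiftExp s 0 : ℕ) := by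
    rintro (s | s)
    · simp only [yShift, shiftExp, Finsupp.single_eq_same]; linear_combination -(s : ℤ) * hσ
    · simp [yShift, shiftExp]
  have hb : ∀ s, (σ : ℤ) * (j - zShift σ s) = σ * j + (shiftExp s 1 : ℕ) := by
    rintro (s | s)
    · simp [zShift, shiftExp]
    · simp only [zShift, shiftExp, Finsupp.single_eq_same]; linear_combination (s : ℤ) * hσ
  by_cases h : 0 ≤ (σ : ℤ) * i ∧ (σ : ℤ) * j ≤ 0
  · rw [edgeCoeff, if_pos h]
    rw [zpow_add_one, zpow_add_one, Units.val_mul, Units.val_mul, coeff_mul_edgeUnit σ]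
    set n : Fin 2 →₀ ℕ := Finsupp.single (0 : Fin 2) ((σ : ℤ) * i).toNat +
          Finsupp.single (1 : Fin 2) (-((σ : ℤ) * j)).toNat with hn
    have hn0 : n 0 = ((σ : ℤ) * i).toNat := by simp [hn]
    have hn1 : n 1 = (-((σ : ℤ) * j)).toNat := by simp [hn]
    have hle : ∀ s, shiftExp s ≤ n ↔
        (0 ≤ (σ : ℤ) * (i - yShift σ s) ∧ (σ : ℤ) * (j - zShift σ s) ≤ 0) := by
      intro s
      rw [ha, hb, Finsupp.le_def, Fin.forall_fin_two, hn0, hn1]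
      omega
    rw [mul_finsum_mem]
    refine finsum_congr fun s => ?_
    by_cases hs : ShiftAdmissible σ s
    · by_cases hsn : shiftExp s ≤ n
      · have hst : n - shiftExp s = Finsupp.single (0 : Fin 2) ((σ : ℤ) * (i - yShift σ s)).toNat +
            Finsupp.single (1 : Fin 2) (-((σ : ℤ) * (j - zShift σ s))).toNat := by
          rw [ha, hb]
          ext k
          fin_cases k
          · simp [hn0]
          · simp [hn1]; omega
        rw [edgeCoeff, if_pos ((hle s).1 hsn), ← hst]
        simp [hs, hsn]
        ring
      · rw [edgeCoeff, if_neg (mt (hle s).2 hsn)]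
        simp [hsn]
    · simp [hs]
  · rw [edgeCoeff, if_neg h]
    symm
    refine finsum_mem_eq_zero_of_forall_eq_zero fun s _ => ?_
    rw [edgeCoeff, if_neg, mul_zero]
    rw [ha, hb]
    omega

/-! ### Positivity of inverse matrices -/

/-- A Stieltjes matrix with connected graph has an entrywise positive inverse. -/
theorem Matrix.PosDef.inv_pos_of_preconnected {W : Type*} [Fintype W] [DecidableEq W]
    {M : Matrix W W ℝ} (hM : M.PosDef) (hoff : ∀ i j, i ≠ j → M i j ≤ 0)
    {G : SimpleGraph W} (hG : G.Preconnected) (hadj : ∀ i j, G.Adj i j → M i j < 0) (i j : W) :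
    0 < M⁻¹ i j := by
  set x : W → ℝ := M⁻¹ *ᵥ Pi.single j 1 with hx
  have hxi : ∀ i, M⁻¹ i j = x i := fun i => by simp [hx]
  have hMx : M *ᵥ x = Pi.single j 1 := by
    rw [hx, Matrix.mulVec_mulVec, Matrix.mul_nonsing_inv _ ((Matrix.isUnit_iff_isUnit_det _).1 hM.isUnit),
      Matrix.one_mulVec]
  have hrow : ∀ a, ∑ b, M a b * x b = if a = j then 1 else 0 := fun a => by
    have := congrFun hMx a
    simpa [Matrix.mulVec, dotProduct, Pi.single_apply] using this
  have hnonneg : ∀ i, 0 ≤ x i := by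
    set m : W → ℝ := fun i => max (-x i) 0 with hm
    have hm0 : m = 0 := by
      by_contra hne
      have h1 := hM.dotProduct_mulVec_pos hne
      have h2 : star m ⬝ᵥ (M *ᵥ m) ≤ - (m ⬝ᵥ (M *ᵥ x)) := by
        simp only [dotProduct, Matrix.mulVec, star_trivial, ← Finset.sum_neg_distrib,
          Finset.mul_sum]
        refine Finset.sum_le_sum fun a _ => Finset.sum_le_sum fun b _ => ?_
        -- `m` is the negative part of `x`, and `m + x` is the positive part
        have hab : m a * M a b * (m b + x b) ≤ 0 := by
          by_cases h : a = b
          · subst h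
            have : m a * (m a + x a) = 0 := by
              simp only [hm]
              rcases le_total (-x a) 0 with h | h
              · simp [max_eq_right h]
              · simp [max_eq_left h]
            rw [mul_right_comm, this, zero_mul]
          · have h3 : 0 ≤ m a := le_max_right _ _
            have h4 : 0 ≤ m b + x b := by
              have : -x b ≤ m b := le_max_left _ _
              linarith
            have h5 := hoff a b h
            nlinarith [mul_nonneg h3 h4]
        linarith
      have h3 : 0 ≤ m ⬝ᵥ (M *ᵥ x) := by
        rw [hMx]
        simp [hm]
      linarith
    intro i
    have := congrFun hm0 i
    simp only [hm, Pi.zero_apply] at this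
    have h1 : -x i ≤ max (-x i) 0 := le_max_left _ _
    linarith
  have hzero : ∀ a, x a = 0 → a ≠ j ∧ ∀ b, G.Adj a b → x b = 0 := by
    intro a ha
    have h1 := hrow a
    have hterm : ∀ b ∈ Finset.univ, M a b * x b ≤ 0 := fun b _ => by
      by_cases h : a = b
      · subst h; simp [ha]
      · exact mul_nonpos_of_nonpos_of_nonneg (hoff a b h) (hnonneg b)
    have haj : a ≠ j := by
      rintro rfl
      have := Finset.sum_nonpos hterm
      simp at h1
      linarith
    refine ⟨haj, fun b hb => ?_⟩
    rw [if_neg haj] at h1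
    have := (Finset.sum_eq_zero_iff_of_nonpos hterm).1 h1 b (Finset.mem_univ _)
    rcases mul_eq_zero.1 this with h | h
    · exact absurd h (hadj a b hb).ne
    · exact h
  rw [hxi]
  refine lt_of_le_of_ne (hnonneg i) fun h => ?_
  obtain ⟨w⟩ := hG i j
  have : x j = 0 := by
    have hwalk : ∀ a b, G.Walk a b → x a = 0 → x b = 0 := by
      intro a b w
      induction w with
      | nil => exact id
      | cons hab _ ih => exact fun h0 => ih ((hzero _ h0).2 _ hab)
    exact hwalk _ _ w h.symm
  exact (hzero j this).1 rfl

/-! ### Linking matrices of glued and of linear plumbings -/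

namespace PlumbingGraph

theorem numPos_eq_zero {V : Type*} [Fintype V] [DecidableEq V] (Γ : PlumbingGraph V)
    (h : ∀ x : V → ℝ, x ⬝ᵥ (Γ.Br *ᵥ x) ≤ 0) : Γ.numPos = 0 := by
  rw [numPos, Multiset.card_eq_zero, Multiset.filter_eq_nil]
  intro μ hμ hpos
  have h1 := Polynomial.isRoot_of_mem_roots hμ
  rw [Polynomial.IsRoot, Matrix.eval_charpoly, ← Matrix.exists_mulVec_eq_zero_iff] at h1
  obtain ⟨x, hx, hx0⟩ := h1
  rw [Matrix.sub_mulVec, sub_eq_zero] at hx0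
  have h2 := h x
  rw [← hx0] at h2
  have h3 : 0 < x ⬝ᵥ x := by
    rcases (dotProduct_self_star_nonneg x).lt_or_eq with h | h
    · simpa using h
    · exact absurd (dotProduct_self_star_eq_zero.1 h.symm) hx
  simp [Matrix.scalar_apply, ← Matrix.smul_one_eq_diagonal, Matrix.smul_mulVec] at h2
  nlinarith

theorem B_symm {V : Type*} (Γ : PlumbingGraph V) : Γ.B.IsSymm := by
  ext i j
  simp only [B, Matrix.transpose_apply, Matrix.of_apply]
  by_cases h : i = j
  · subst h; rfl
  · simp only [h, Ne.symm h, if_false]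
    congr 1
    exact propext (Γ.graph.adj_comm j i)

section GlueRight

variable {V W : Type*} (v₁ : V) (v₂ : W)

open Classical in
/-- The inclusion of the second graph into the glued graph. -/
noncomputable def glueRight (w : W) : V ⊕ {w : W // w ≠ v₂} :=
  if h : w = v₂ then Sum.inl v₁ else Sum.inr ⟨w, h⟩

theorem glueRight_self : glueRight v₁ v₂ v₂ = Sum.inl v₁ := by simp [glueRight]

theorem glueRight_of_ne (w : {w : W // w ≠ v₂}) : glueRight v₁ v₂ w = Sum.inr w := by
  simp [glueRight, w.2]

theorem glueRight_injective : Function.Injective (glueRight v₁ v₂) := by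
  intro a b h
  by_cases ha : a = v₂ <;> by_cases hb : b = v₂ <;> simp [glueRight, ha, hb] at h
  · rw [ha, hb]
  · exact h

end GlueRight

section Glue

variable {V W : Type*} [DecidableEq V] (Γ₁ : PlumbingGraph V) (v₁ : V)
    (Γ₂ : PlumbingGraph W) (v₂ : W)

theorem glue_B_inl_inl (x y : V) : (Γ₁.glue v₁ Γ₂ v₂).B (Sum.inl x) (Sum.inl y) =
    Γ₁.B x y + if x = y ∧ x = v₁ then Γ₂.B v₂ v₂ else 0 := by
  simp only [B, Matrix.of_apply, Sum.inl.injEq]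
  by_cases h : x = y
  · subst h; simp [glue]
  · simp only [h, glue, if_false, false_and, add_zero]
    congr 1

theorem glue_B_inl_inr (x : V) (y : {w : W // w ≠ v₂}) :
    (Γ₁.glue v₁ Γ₂ v₂).B (Sum.inl x) (Sum.inr y) = if x = v₁ then Γ₂.B v₂ y else 0 := by
  simp only [B, Matrix.of_apply]
  by_cases h : x = v₁
  · simp only [h, glue, y.2.symm, if_false, if_true, reduceCtorEq]
    congr 1
    exact propext (and_iff_right h)
  · simp [h, glue]

theorem glue_B_inr_inl (x : {w : W // w ≠ v₂}) (y : V) :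
    (Γ₁.glue v₁ Γ₂ v₂).B (Sum.inr x) (Sum.inl y) = if y = v₁ then Γ₂.B x v₂ else 0 := by
  rw [← (B_symm _).apply, glue_B_inl_inr, ← Γ₂.B_symm.apply]

theorem glue_B_inr_inr (x y : {w : W // w ≠ v₂}) :
    (Γ₁.glue v₁ Γ₂ v₂).B (Sum.inr x) (Sum.inr y) = Γ₂.B x y := by
  simp only [B, Matrix.of_apply]
  by_cases h : x = y
  · subst h; simp [glue]
  · have : (x : W) ≠ y := fun h' => h (Subtype.ext h')
    simp only [h, this, glue, if_false, Sum.inr.injEq]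
    congr 1

/-- The linking matrix of a glued plumbing, applied to a pair of vectors that agree at the glued
vertex. -/
theorem glue_mulVec [Fintype V] [Fintype W] [DecidableEq W] {R : Type*} [CommRing R]
    (f : V → R) (u : W → R) (h : u v₂ = f v₁) :
    (Γ₁.glue v₁ Γ₂ v₂).B.map (Int.cast : ℤ → R) *ᵥ
        Sum.elim f (fun w : {w : W // w ≠ v₂} => u w) =
      Sum.elim
        (fun x => (Γ₁.B.map (Int.cast : ℤ → R) *ᵥ f) x +
          if x = v₁ then (Γ₂.B.map (Int.cast : ℤ → R) *ᵥ u) v₂ else 0)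
        (fun w : {w : W // w ≠ v₂} => (Γ₂.B.map (Int.cast : ℤ → R) *ᵥ u) w) := by
  ext (x | x)
  · simp only [Matrix.mulVec, dotProduct, Fintype.sum_sum_type, Sum.elim_inl, Sum.elim_inr,
      Matrix.map_apply, glue_B_inl_inl, glue_B_inl_inr]
    rw [Fintype.sum_eq_add_sum_subtype_ne _ v₂]
    by_cases hx : x = v₁
    · subst hx
      simp [add_mul, Finset.sum_add_distrib, h, add_assoc]
    · simp [hx]
  · simp only [Matrix.mulVec, dotProduct, Fintype.sum_sum_type, Sum.elim_inl, Sum.elim_inr,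
      Matrix.map_apply, glue_B_inr_inl, glue_B_inr_inr]
    rw [Fintype.sum_eq_add_sum_subtype_ne _ v₂]
    simp [h]

theorem glue_adj_glueRight {a b : W} (h : Γ₂.graph.Adj a b) :
    (Γ₁.glue v₁ Γ₂ v₂).graph.Adj (glueRight v₁ v₂ a) (glueRight v₁ v₂ b) := by
  by_cases ha : a = v₂ <;> by_cases hb : b = v₂ <;> simp only [glueRight, ha, hb, glue, dif_pos,
    dif_neg, not_false_eq_true]
  · subst ha hb; exact absurd h (Γ₂.graph.loopless.irrefl _)
  · subst ha; exact ⟨trivial, h⟩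
  · subst hb; exact ⟨trivial, h.symm⟩
  · exact h

theorem glue_preconnected (h₁ : Γ₁.graph.Preconnected) (h₂ : Γ₂.graph.Preconnected) :
    (Γ₁.glue v₁ Γ₂ v₂).graph.Preconnected := by
  let f₁ : Γ₁.graph →g (Γ₁.glue v₁ Γ₂ v₂).graph := ⟨Sum.inl, fun h => h⟩
  let f₂ : Γ₂.graph →g (Γ₁.glue v₁ Γ₂ v₂).graph :=
    ⟨glueRight v₁ v₂, fun h => glue_adj_glueRight Γ₁ v₁ Γ₂ v₂ h⟩
  have key : ∀ a, (Γ₁.glue v₁ Γ₂ v₂).graph.Reachable (Sum.inl v₁) a := by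
    rintro (a | a)
    · exact (h₁ v₁ a).map f₁
    · have := (h₂ v₂ a).map f₂
      simpa only [f₂, RelHom.coeFn_mk, glueRight_self, glueRight_of_ne] using this
  exact fun a b => (key a).symm.trans (key b)

theorem glue_deg_inl_of_ne (x : V) (hx : x ≠ v₁) :
    (Γ₁.glue v₁ Γ₂ v₂).deg (Sum.inl x) = Γ₁.deg x := by
  rw [deg, deg, ← Set.ncard_image_of_injective (Γ₁.graph.neighborSet x) (Sum.inl_injective (β := {w : W // w ≠ v₂}))]
  congr 1
  ext (y | y)
  · simp [glue]
  · simp [glue, hx]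

theorem glue_deg_inr (x : {w : W // w ≠ v₂}) :
    (Γ₁.glue v₁ Γ₂ v₂).deg (Sum.inr x) = Γ₂.deg x := by
  rw [deg, deg, ← Set.ncard_image_of_injective (Γ₂.graph.neighborSet x) (glueRight_injective v₁ v₂)]
  congr 1
  ext (y | y)
  · simp only [SimpleGraph.mem_neighborSet, Set.mem_image]
    constructor
    · rintro ⟨rfl, h⟩
      exact ⟨v₂, h.symm, glueRight_self _ _⟩
    · rintro ⟨w, h, hw⟩
      have := glue_adj_glueRight Γ₁ v₁ Γ₂ v₂ h
      rwa [hw, glueRight_of_ne] at this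
  · simp only [SimpleGraph.mem_neighborSet, Set.mem_image]
    constructor
    · intro h
      exact ⟨y, h, glueRight_of_ne _ _ _⟩
    · rintro ⟨w, h, hw⟩
      have := glue_adj_glueRight Γ₁ v₁ Γ₂ v₂ h
      rwa [hw, glueRight_of_ne] at this

theorem glue_deg_inl_self [Finite V] [Finite W] :
    (Γ₁.glue v₁ Γ₂ v₂).deg (Sum.inl v₁) = Γ₁.deg v₁ + Γ₂.deg v₂ := by
  rw [deg, deg, deg, ← Set.ncard_image_of_injective (Γ₂.graph.neighborSet v₂)
      (glueRight_injective v₁ v₂),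
    ← Set.ncard_image_of_injective (Γ₁.graph.neighborSet v₁) (Sum.inl_injective (β := {w : W // w ≠ v₂})),
    ← Set.ncard_union_eq _ (Set.toFinite _) (Set.toFinite _)]
  · congr 1
    ext (y | y)
    · simp only [SimpleGraph.mem_neighborSet, Set.mem_image, Set.mem_union, Sum.inl.injEq,
        exists_eq_right]
      constructor
      · exact fun h => Or.inl h
      · rintro (h | ⟨w, h, hw⟩)
        · exact h
        · have := glue_adj_glueRight Γ₁ v₁ Γ₂ v₂ h
          rwa [hw, glueRight_self] at this
    · simp only [SimpleGraph.mem_neighborSet, Set.mem_image, Set.mem_union, reduceCtorEq, and_false,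
        exists_false, false_or]
      constructor
      · rintro ⟨_, h⟩
        exact ⟨y, h, glueRight_of_ne _ _ _⟩
      · rintro ⟨w, h, hw⟩
        have := glue_adj_glueRight Γ₁ v₁ Γ₂ v₂ h
        rwa [hw, glueRight_self] at this
  · rw [Set.disjoint_left]
    rintro _ ⟨y, _, rfl⟩ ⟨w, hw, h⟩
    have : w = v₂ := by
      by_contra hne
      simp [glueRight, hne] at h
    subst this
    exact Γ₂.graph.loopless.irrefl _ hw

end Glue

section Chain

variable {ℓ : ℕ} (k : Fin (ℓ + 1) → ℤ)

theorem chain_adj (i j : Fin (ℓ + 1)) :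
    (chain k).graph.Adj i j ↔ (i : ℕ) + 1 = j ∨ (j : ℕ) + 1 = i := SimpleGraph.pathGraph_adj

theorem chain_mulVec {R : Type*} [CommRing R] (u : ℕ → R) (j : Fin (ℓ + 1)) :
    ((chain k).B.map (Int.cast : ℤ → R) *ᵥ fun i => u i) j =
      (if (j : ℕ) = 0 then 0 else u (j - 1)) + k j * u j +
        (if (j : ℕ) = ℓ then 0 else u (j + 1)) := by
  have hB : ∀ i : Fin (ℓ + 1), (((chain k).B j i : ℤ) : R) * u i =
      (if (i : ℕ) + 1 = j then u i else 0) + (if j = i then (k j : R) * u j else 0) +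
        (if (j : ℕ) + 1 = i then u i else 0) := by
    intro i
    simp only [B, Matrix.of_apply, chain_adj]
    by_cases hij : j = i
    · subst hij; simp [chain]
    · by_cases h1 : (i : ℕ) + 1 = j <;> by_cases h2 : (j : ℕ) + 1 = i
      · omega
      all_goals simp [hij, h1, h2]
  simp only [Matrix.mulVec, dotProduct, Matrix.map_apply, hB, Finset.sum_add_distrib]
  congr 1
  · congr 1
    · split_ifs with h
      · exact Finset.sum_eq_zero fun i _ => if_neg (by omega)
      · rw [Finset.sum_eq_single ⟨j - 1, by omega⟩]
        · simp only [if_pos (show (j : ℕ) - 1 + 1 = j by omega)]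
        · intro i _ hi
          exact if_neg fun h' => hi (Fin.ext (by simp; omega))
        · simp
    · simp
  · split_ifs with h
    · exact Finset.sum_eq_zero fun i _ => if_neg (by omega)
    · rw [Finset.sum_eq_single ⟨j + 1, by omega⟩]
      · simp
      · intro i _ hi
        exact if_neg fun h' => hi (Fin.ext (by simp; omega))
      · simp

theorem chain_deg_zero (h : ℓ = 0) (j : Fin (ℓ + 1)) : (chain k).deg j = 0 := by
  subst h
  rw [deg, Set.ncard_eq_zero]
  ext i
  simp only [SimpleGraph.mem_neighborSet, chain_adj, Set.mem_empty_iff_false, iff_false]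
  omega

theorem chain_deg_first (h : ℓ ≠ 0) : (chain k).deg 0 = 1 := by
  rw [deg, Set.ncard_eq_one]
  refine ⟨⟨1, by omega⟩, ?_⟩
  ext i
  simp only [SimpleGraph.mem_neighborSet, chain_adj, Set.mem_singleton_iff, Fin.ext_iff]
  simp
  omega

theorem chain_deg_last (h : ℓ ≠ 0) : (chain k).deg (Fin.last ℓ) = 1 := by
  rw [deg, Set.ncard_eq_one]
  refine ⟨⟨ℓ - 1, by omega⟩, ?_⟩
  ext i
  simp only [SimpleGraph.mem_neighborSet, chain_adj, Set.mem_singleton_iff, Fin.ext_iff]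
  simp
  omega

theorem chain_deg_middle (j : Fin (ℓ + 1)) (h0 : j ≠ 0) (h1 : j ≠ Fin.last ℓ) :
    (chain k).deg j = 2 := by
  have h0' : (j : ℕ) ≠ 0 := fun h => h0 (Fin.ext h)
  have h1' : (j : ℕ) ≠ ℓ := fun h => h1 (Fin.ext h)
  rw [deg, Set.ncard_eq_two]
  refine ⟨⟨j - 1, by omega⟩, ⟨j + 1, by omega⟩, by simp [Fin.ext_iff], ?_⟩
  ext i
  simp only [SimpleGraph.mem_neighborSet, chain_adj, Set.mem_insert_iff, Set.mem_singleton_iff, Fin.ext_iff]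
  omega

end Chain

end PlumbingGraph

/-! ### Continued fractions -/

theorem exists_two_step_recursion {α : Type*} (a b : α) (F : ℕ → α → α → α) :
    ∃ G : ℕ → α, G 0 = a ∧ G 1 = b ∧ ∀ i, G (i + 2) = F i (G (i + 1)) (G i) := by
  let P : ℕ → α × α := fun n => Nat.rec (a, b) (fun i q => (q.2, F i q.2 q.1)) n
  exact ⟨fun n => (P n).1, rfl, rfl, fun i => rfl⟩

/-- The kernel recursion of a linear plumbing away from its first vertex. Consecutive entries of
its solution are the numerators and denominators of the tails of the continued fraction. -/
theorem exists_chain_vector {ℓ : ℕ} (k : Fin (ℓ + 1) → ℤ) :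
    ∃ u : ℕ → ℤ, u ℓ = 1 ∧ u (ℓ + 1) = 0 ∧
      (∀ j : Fin (ℓ + 1), (j : ℕ) ≠ 0 → u (j - 1) + k j * u j + u (j + 1) = 0) ∧
      IsCoprime (u 0) (u 1) := by
  obtain ⟨G, h0, h1, hG⟩ := exists_two_step_recursion (0 : ℤ) 1
    (fun i a b => -(if h : ℓ - i < ℓ + 1 then k ⟨ℓ - i, h⟩ else 0) * a - b)
  have hcop : ∀ i, IsCoprime (G (i + 1)) (G i) := by
    intro i
    induction i with
    | zero => rw [h0, h1]; exact isCoprime_one_left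
    | succ i ih =>
      rw [hG i, sub_eq_add_neg, add_comm, mul_comm]
      exact (ih.symm.neg_left).add_mul_left_left _
  refine ⟨fun j => G (ℓ + 1 - j), by simp [h1], by simp [h0], ?_, ?_⟩
  · intro j hj
    have h2 := hG (ℓ - j)
    have hj' := j.2
    have e1 : ℓ + 1 - (j - 1) = ℓ - j + 2 := by omega
    have e2 : ℓ + 1 - (j : ℕ) = ℓ - j + 1 := by omega
    have e3 : ℓ + 1 - ((j : ℕ) + 1) = ℓ - j := by omega
    have e4 : ℓ - (ℓ - (j : ℕ)) = j := by omega
    simp only [e1, e2, e3, h2, e4, hj', dif_pos]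
    ring
  · simpa using hcop ℓ

theorem contFrac_ofFn {ℓ : ℕ} (k : Fin (ℓ + 1) → ℤ) (u : ℕ → ℤ) (h0 : u (ℓ + 1) = 0)
    (hu : ∀ j : Fin (ℓ + 1), (j : ℕ) ≠ 0 → u (j - 1) + k j * u j + u (j + 1) = 0)
    (hne : ∀ j ≤ ℓ, u j ≠ 0) :
    contFrac (List.ofFn k) = ((k 0 * u 0 + u 1 : ℤ) : ℚ) / (u 0 : ℚ) := by
  induction ℓ generalizing u with
  | zero =>
    have : (u 0 : ℚ) ≠ 0 := by exact_mod_cast hne 0 le_rfl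
    simp only [zero_add] at h0
    simp [contFrac, h0, this]
  | succ ℓ ih =>
    have h1 := ih (fun i => k i.succ) (fun j => u (j + 1)) h0
      (fun j hj => by
        have := hu j.succ (by simp)
        simp only [Fin.val_succ, Nat.add_sub_cancel] at this
        rwa [Nat.sub_add_cancel (by omega)])
      (fun j hj => hne (j + 1) (by omega))
    have h2 := hu 1 (by simp)
    have h3 : (u 0 : ℚ) ≠ 0 := by exact_mod_cast hne 0 (by omega)
    have h4 : (u 1 : ℚ) ≠ 0 := by exact_mod_cast hne 1 (by omega)
    simp only [Fin.val_one, Nat.sub_self] at h2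
    simp only [Fin.succ_zero_eq_one, zero_add] at h1
    have h5 : k 1 * u 1 + u (1 + 1) = - u 0 := by linarith
    rw [h5] at h1
    rw [List.ofFn_succ, contFrac, h1]
    push_cast
    field_simp
    ring

namespace PlumbingGraph

/-! ### Negative definite plumbings -/

theorem Bq_isSymm {W : Type*} (Γ : PlumbingGraph W) : Γ.Bq.IsSymm := Γ.B_symm.map _

section Definite

variable {W : Type*} [Fintype W] [DecidableEq W] {Γ : PlumbingGraph W}

theorem IsNegDef.det_Br_isUnit (h : Γ.IsNegDef) : IsUnit Γ.Br.det := by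
  have := (Matrix.isUnit_iff_isUnit_det _).1 (Matrix.PosDef.isUnit h)
  rw [Matrix.det_neg] at this
  exact isUnit_of_mul_isUnit_right this

theorem IsNegDef.det_Bq_isUnit (h : Γ.IsNegDef) : IsUnit Γ.Bq.det := by
  have h1 := h.det_Br_isUnit
  have e1 : Γ.Br.det = ((Γ.B.det : ℤ) : ℝ) := ((Int.castRingHom ℝ).map_det Γ.B).symm
  have e2 : Γ.Bq.det = ((Γ.B.det : ℤ) : ℚ) := ((Int.castRingHom ℚ).map_det Γ.B).symm
  rw [e1, isUnit_iff_ne_zero] at h1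
  rw [e2, isUnit_iff_ne_zero]
  exact_mod_cast h1

/-- All entries of the inverse linking matrix of a connected negative definite plumbing are
negative. -/
theorem IsNegDef.Br_inv_neg (h : Γ.IsNegDef) (hc : Γ.graph.Preconnected) (i j : W) :
    Γ.Br⁻¹ i j < 0 := by
  have h1 := Matrix.PosDef.inv_pos_of_preconnected h
    (fun i j hij => by
      simp only [Br, B, Matrix.neg_apply, Matrix.map_apply, Matrix.of_apply, if_neg hij]
      split_ifs <;> simp) hc
    (fun i j hij => by
      simp [Br, B, hij, hij.ne]) i j
  have h2 : (-Γ.Br)⁻¹ = -Γ.Br⁻¹ := by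
    apply Matrix.inv_eq_right_inv
    rw [neg_mul_neg, Matrix.mul_nonsing_inv _ h.det_Br_isUnit]
  rw [h2, Matrix.neg_apply] at h1
  linarith

theorem IsNegDef.Bq_inv_neg (h : Γ.IsNegDef) (hc : Γ.graph.Preconnected) (i j : W) :
    Γ.Bq⁻¹ i j < 0 := by
  have h1 : Γ.Br⁻¹ = (Γ.Bq⁻¹).map (Rat.cast : ℚ → ℝ) := by
    apply Matrix.inv_eq_right_inv
    have h2 : Γ.Br = Γ.Bq.map (Rat.cast : ℚ → ℝ) := by ext; simp [Br, Bq]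
    rw [h2]
    have h3 := congrArg (fun M : Matrix W W ℚ => M.map (Rat.castHom ℝ))
      (Matrix.mul_nonsing_inv _ h.det_Bq_isUnit)
    rw [Matrix.map_mul] at h3
    simpa using h3
  have h2 := h.Br_inv_neg hc i j
  rw [h1, Matrix.map_apply] at h2
  exact_mod_cast h2

theorem qExponent_swap (Γ : PlumbingGraph W) (l₁ l₂ : W → ℤ) :
    Γ.qExponent (l₁, l₂) = Γ.qExponent (l₂, l₁) := by
  have : (Γ.Bq⁻¹)ᵀ = Γ.Bq⁻¹ := by rw [Matrix.transpose_nonsing_inv, Γ.Bq_isSymm]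
  simp only [qExponent]
  rw [dotProduct_comm, Matrix.dotProduct_mulVec, ← Matrix.mulVec_transpose, this]

/-- The sign conditions satisfied by the exponents that occur in the chamber `σ`. -/
def InCone (σ : ℤˣ) (l : (W → ℤ) × (W → ℤ)) : Prop :=
  ∀ w, (σ : ℤ) * l.1 w ≤ 0 ∧ 0 ≤ (σ : ℤ) * l.2 w

theorem IsNegDef.exists_le_qExponent (h : Γ.IsNegDef) (hc : Γ.graph.Preconnected) (σ : ℤˣ) :
    ∃ δ : ℚ, 0 < δ ∧ ∀ l, InCone σ l → ∀ i j,
      δ * (|(l.1 i : ℚ)| * |(l.2 j : ℚ)|) ≤ Γ.qExponent l := by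
  rcases isEmpty_or_nonempty W with hW | hW
  · exact ⟨1, one_pos, fun _ _ i => (hW.false i).elim⟩
  obtain ⟨⟨a, b⟩, hab⟩ := Finite.exists_max fun q : W × W => Γ.Bq⁻¹ q.1 q.2
  refine ⟨-(Γ.Bq⁻¹ a b), by linarith [h.Bq_inv_neg hc a b], fun l hl i j => ?_⟩
  have hσ := units_mul_self σ
  have hle : ∀ x y, (l.1 x : ℚ) * l.2 y = -(|(l.1 x : ℚ)| * |(l.2 y : ℚ)|) := fun x y => by
    have h1 := (hl x).1
    have h2 := (hl y).2
    rcases Int.units_eq_one_or σ with rfl | rfl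
    · have h3 : (l.1 x : ℚ) ≤ 0 := by exact_mod_cast (by simpa using h1)
      have h4 : (0 : ℚ) ≤ l.2 y := by exact_mod_cast (by simpa using h2)
      rw [abs_of_nonpos h3, abs_of_nonneg h4]; ring
    · have h3 : (0 : ℚ) ≤ l.1 x := by exact_mod_cast (by simpa using h1)
      have h4 : (l.2 y : ℚ) ≤ 0 := by exact_mod_cast (by simpa using h2)
      rw [abs_of_nonneg h3, abs_of_nonpos h4]; ring
  have hterm : ∀ x y, (l.1 x : ℚ) * (Γ.Bq⁻¹ x y * l.2 y) =
      -(Γ.Bq⁻¹ x y) * (|(l.1 x : ℚ)| * |(l.2 y : ℚ)|) := fun x y => by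
    linear_combination Γ.Bq⁻¹ x y * hle x y
  have hnn : ∀ x y, 0 ≤ (l.1 x : ℚ) * (Γ.Bq⁻¹ x y * l.2 y) := fun x y => by
    rw [hterm]
    have := h.Bq_inv_neg hc x y
    have : 0 ≤ -(Γ.Bq⁻¹ x y) := by linarith
    positivity
  calc _ ≤ (l.1 i : ℚ) * (Γ.Bq⁻¹ i j * l.2 j) := by
        rw [hterm]
        have := hab (i, j)
        simp only at this
        gcongr
    _ ≤ ∑ y, (l.1 i : ℚ) * (Γ.Bq⁻¹ i y * l.2 y) :=
        Finset.single_le_sum (f := fun y => (l.1 i : ℚ) * (Γ.Bq⁻¹ i y * l.2 y))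
          (fun y _ => hnn i y) (Finset.mem_univ j)
    _ ≤ ∑ x, ∑ y, (l.1 x : ℚ) * (Γ.Bq⁻¹ x y * l.2 y) :=
        Finset.single_le_sum (f := fun x => ∑ y, (l.1 x : ℚ) * (Γ.Bq⁻¹ x y * l.2 y))
          (fun x _ => Finset.sum_nonneg fun y _ => hnn x y) (Finset.mem_univ i)
    _ = Γ.qExponent l := by
        simp [qExponent, dotProduct, Matrix.mulVec, Finset.mul_sum]

/-- On the cone of a chamber the exponent vanishes only for trivial reasons. -/
theorem IsNegDef.qExponent_ne_zero (h : Γ.IsNegDef) (hc : Γ.graph.Preconnected) {σ : ℤˣ}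
    {l : (W → ℤ) × (W → ℤ)} (hl : InCone σ l) (h1 : l.1 ≠ 0) (h2 : l.2 ≠ 0) :
    Γ.qExponent l ≠ 0 := by
  obtain ⟨δ, hδ, hle⟩ := h.exists_le_qExponent hc σ
  obtain ⟨i, hi⟩ := Function.ne_iff.1 h1
  obtain ⟨j, hj⟩ := Function.ne_iff.1 h2
  have hi' : (l.1 i : ℚ) ≠ 0 := by exact_mod_cast hi
  have hj' : (l.2 j : ℚ) ≠ 0 := by exact_mod_cast hj
  have : 0 < δ * (|(l.1 i : ℚ)| * |(l.2 j : ℚ)|) := by positivity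
  exact (this.trans_le (hle l hl i j)).ne'

/-- On the cone of a chamber there are finitely many vectors with a bounded nonzero exponent. -/
theorem IsNegDef.finite_qExponent_le (h : Γ.IsNegDef) (hc : Γ.graph.Preconnected) (σ : ℤˣ)
    (E : ℚ) : {l | InCone σ l ∧ Γ.qExponent l ≤ E ∧ Γ.qExponent l ≠ 0}.Finite := by
  obtain ⟨δ, hδ, hle⟩ := h.exists_le_qExponent hc σ
  set N : ℤ := ⌈E / δ⌉ with hN
  refine ((Set.finite_Icc (fun _ : W => -N) (fun _ => N)).prod
    (Set.finite_Icc (fun _ : W => -N) (fun _ => N))).subset ?_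
  rintro l ⟨hl, hE, hne⟩
  have h1 : ∃ i, l.1 i ≠ 0 := by
    by_contra! h0
    exact hne (by simp [qExponent, dotProduct, h0])
  have h2 : ∃ i, l.2 i ≠ 0 := by
    by_contra! h0
    exact hne (by simp [qExponent, dotProduct, Matrix.mulVec, h0])
  obtain ⟨i, hi⟩ := h1
  obtain ⟨j, hj⟩ := h2
  have hi' : (1 : ℚ) ≤ |(l.1 i : ℚ)| := by exact_mod_cast Int.one_le_abs hi
  have hj' : (1 : ℚ) ≤ |(l.2 j : ℚ)| := by exact_mod_cast Int.one_le_abs hj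
  have hprod : ∀ x y, |(l.1 x : ℚ)| * |(l.2 y : ℚ)| ≤ N := fun x y => by
    refine le_trans ?_ (Int.le_ceil _)
    rw [le_div_iff₀ hδ, mul_comm]
    exact (hle l hl x y).trans hE
  have hb1 : ∀ x, |l.1 x| ≤ N := fun x => by
    have h3 := hprod x j
    have : |(l.1 x : ℚ)| ≤ N := by nlinarith [abs_nonneg (l.1 x : ℚ)]
    exact_mod_cast this
  have hb2 : ∀ x, |l.2 x| ≤ N := fun x => by
    have h3 := hprod i x
    have : |(l.2 x : ℚ)| ≤ N := by nlinarith [abs_nonneg (l.2 x : ℚ)]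
    exact_mod_cast this
  exact ⟨⟨fun x => (abs_le.1 (hb1 x)).1, fun x => (abs_le.1 (hb1 x)).2⟩,
    ⟨fun x => (abs_le.1 (hb2 x)).1, fun x => (abs_le.1 (hb2 x)).2⟩⟩

end Definite

/-! ### Knots in integral homology spheres -/

section Ambient

variable {V : Type*} [Fintype V] [DecidableEq V] (Γ : PlumbingGraph V) (v : V)

theorem mulVec_of_ne (n : V → ℤ) (w : {w : V // w ≠ v}) :
    (Γ.B *ᵥ n) w = Γ.B w v * n v + (Γ.ambientB v *ᵥ fun x => n x) w := by
  simp only [Matrix.mulVec, dotProduct, ambientB, Matrix.submatrix_apply]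
  exact Fintype.sum_eq_add_sum_subtype_ne (fun x => Γ.B w x * n x) v

variable {Γ v}

/-- If the ambient manifold is an integral homology sphere, the linking equations away from the
distinguished vertex can be solved over the integers, with any value at the distinguished vertex. -/
theorem exists_solution (h : IsUnit (Γ.ambientB v).det) (t : ℤ) (a : V → ℤ) :
    ∃ n : V → ℤ, n v = t ∧ ∀ w, w ≠ v → (Γ.B *ᵥ n) w = a w := by
  classical
  set x := (Γ.ambientB v)⁻¹ *ᵥ fun w : {w : V // w ≠ v} => a w - Γ.B w v * t with hx
  have hx' : Γ.ambientB v *ᵥ x = fun w : {w : V // w ≠ v} => a w - Γ.B w v * t := by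
    rw [hx, Matrix.mulVec_mulVec, Matrix.mul_nonsing_inv _ h, Matrix.one_mulVec]
  refine ⟨fun w => if hw : w = v then t else x ⟨w, hw⟩, by simp, fun w hw => ?_⟩
  have e : (fun y : {w : V // w ≠ v} => (fun w => if hw : w = v then t else x ⟨w, hw⟩) (y : V)) = x := by
    ext y; simp [y.2]
  rw [Γ.mulVec_of_ne v _ ⟨w, hw⟩, e, hx']
  simp

theorem solution_unique (h : IsUnit (Γ.ambientB v).det) {n m : V → ℤ} (hv : n v = m v)
    (hw : ∀ w, w ≠ v → (Γ.B *ᵥ n) w = (Γ.B *ᵥ m) w) : n = m := by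
  have h1 : (fun x : {w : V // w ≠ v} => n x) = fun x : {w : V // w ≠ v} => m x := by
    apply Matrix.mulVec_injective_of_isUnit ((Matrix.isUnit_iff_isUnit_det _).2 h)
    ext w
    have := hw w w.2
    rw [mulVec_of_ne, mulVec_of_ne, hv] at this
    linarith
  ext w
  by_cases hwv : w = v
  · rw [hwv, hv]
  · exact congrFun h1 ⟨w, hwv⟩

/-- The Seifert framing yields an integral kernel vector, the class of the Seifert surface. -/
theorem exists_kernel (h : IsUnit (Γ.ambientB v).det) (hdet : Γ.B.det = 0) :
    ∃ e : V → ℤ, e v = 1 ∧ Γ.B *ᵥ e = 0 := by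
  obtain ⟨e, hev, he⟩ := exists_solution h 1 0
  obtain ⟨x, hx, hx0⟩ := Matrix.exists_mulVec_eq_zero_iff.2 hdet
  refine ⟨e, hev, ?_⟩
  have he' : Γ.B *ᵥ e = Pi.single v ((Γ.B *ᵥ e) v) := by
    ext w
    by_cases hw : w = v
    · subst hw; simp
    · simp [hw, he w hw]
  have hxv : x v ≠ 0 := fun h0 => hx (solution_unique h (by simp [h0]) (by simp [hx0]))
  have h1 : x ⬝ᵥ (Γ.B *ᵥ e) = 0 := by
    rw [Matrix.dotProduct_mulVec, ← Matrix.mulVec_transpose, Γ.B_symm, hx0, zero_dotProduct]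
  rw [he', dotProduct_single] at h1
  rw [he', (mul_eq_zero.1 h1).resolve_left hxv, Pi.single_zero]

end Ambient

theorem exists_deg_eq_one {V : Type*} [Fintype V] (Γ : PlumbingGraph V) (h : Γ.graph.IsTree)
    [Nontrivial V] : ∃ w, Γ.deg w = 1 := by
  classical
  obtain ⟨w, hw⟩ := h.exists_vert_degree_one_of_nontrivial
  refine ⟨w, ?_⟩
  rw [deg, Set.ncard_eq_toFinset_card', ← hw]
  rfl

end PlumbingGraph

open PlumbingGraph

/-! ### The linking matrix of the surgered manifold -/

/-- The vertex set of the plumbing of a surgered manifold. -/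
abbrev SurgeryVertex (V : Type*) (ℓ : ℕ) := V ⊕ {i : Fin (ℓ + 1) // i ≠ 0}

/-- The end of the glued linear plumbing. It is the glued vertex if the linear plumbing is a
single vertex. -/
noncomputable def lastVertex {V : Type*} (v : V) (ℓ : ℕ) : SurgeryVertex V ℓ :=
  glueRight v 0 (Fin.last ℓ)

section LastVertex

variable {V : Type*} (v : V) (ℓ : ℕ)

theorem inl_eq_lastVertex (x : V) : Sum.inl x = lastVertex v ℓ ↔ x = v ∧ ℓ = 0 := by
  rcases eq_or_ne ℓ 0 with rfl | h
  · simp [lastVertex, glueRight]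
  · have : Fin.last ℓ ≠ 0 := fun h' => h (by simpa [Fin.ext_iff] using h')
    simp [lastVertex, glueRight, this, h]

theorem inr_eq_lastVertex (i : {i : Fin (ℓ + 1) // i ≠ 0}) :
    Sum.inr i = lastVertex v ℓ ↔ (i : Fin (ℓ + 1)) = Fin.last ℓ := by
  by_cases h : Fin.last ℓ = 0
  · have : (i : Fin (ℓ + 1)) ≠ Fin.last ℓ := by rw [h]; exact i.2
    simp [lastVertex, glueRight, h, i.2]
  · simp [lastVertex, glueRight, h, Subtype.ext_iff]

end LastVertex

theorem surgeryGraph_preconnected {V : Type*} [DecidableEq V] {Γ : PlumbingGraph V} {v : V} {ℓ : ℕ}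
    (hΓ : Γ.graph.IsTree) (k : Fin (ℓ + 1) → ℤ) :
    (surgeryGraph Γ v k).graph.Preconnected :=
  glue_preconnected _ _ _ _ hΓ.connected.preconnected (SimpleGraph.pathGraph_preconnected _)

theorem map_intCast_int {U : Type*} (M : Matrix U U ℤ) : M.map (Int.cast : ℤ → ℤ) = M := by
  ext; simp

theorem intCast_mulVec {R U : Type*} [CommRing R] [Fintype U] (M : Matrix U U ℤ) (x : U → ℤ)
    (i : U) : (((M *ᵥ x) i : ℤ) : R) = (M.map (Int.cast : ℤ → R) *ᵥ fun j => (x j : R)) i :=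
  (Int.castRingHom R).map_mulVec M x i

variable {V : Type*} [Fintype V] [DecidableEq V] {Γ : PlumbingGraph V} {v : V} {ℓ : ℕ}
  {k : Fin (ℓ + 1) → ℤ} {p r : ℤ}

/-- The linking matrix of the surgered manifold applied to a vector that is given on the linear
plumbing by a sequence; the last term compensates for the successor of the last vertex. -/
theorem surgeryGraph_mulVec (f : V → ℤ) (u : ℕ → ℤ) (h : u 0 = f v) :
    (surgeryGraph Γ v k).B *ᵥ Sum.elim f (fun i : {i : Fin (ℓ + 1) // i ≠ 0} => u (i : Fin (ℓ + 1))) =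
      Sum.elim (fun x => (Γ.B *ᵥ f) x + if x = v then k 0 * u 0 + u 1 else 0)
        (fun i : {i : Fin (ℓ + 1) // i ≠ 0} =>
          u ((i : Fin (ℓ + 1)) - 1 : ℕ) + k i * u (i : Fin (ℓ + 1)) +
          u ((i : Fin (ℓ + 1)) + 1 : ℕ)) -
      Pi.single (lastVertex v ℓ) (u (ℓ + 1)) := by
  have h1 := glue_mulVec Γ v (chain k) 0 (R := ℤ) f (fun i => u i) h
  have h2 := chain_mulVec k (R := ℤ) u
  simp only [map_intCast_int] at h1 h2
  refine h1.trans ?_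
  ext (x | x)
  · simp only [Sum.elim_inl, Pi.sub_apply, Pi.single_apply, inl_eq_lastVertex, h2]
    by_cases hx : x = v
    · rcases eq_or_ne ℓ 0 with hl | hl
      · subst hl; simp [hx]; ring
      · simp [hx, hl, hl.symm]
    · simp [hx]
  · have hx : ((x : Fin (ℓ + 1)) : ℕ) ≠ 0 := fun h => x.2 (Fin.ext h)
    simp only [Sum.elim_inr, Pi.sub_apply, Pi.single_apply, inr_eq_lastVertex, h2, hx, if_false,
      Fin.ext_iff, Fin.val_last]
    by_cases hl : ((x : Fin (ℓ + 1)) : ℕ) = ℓ <;> simp [hl]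

/-- The data of the surgery formula. The vector `e` spans the kernel of the linking matrix of the
knot, and `h` is the column of the adjugate matrix of the surgered manifold at the glued vertex, up
to sign: it is mapped to a multiple `c` of the standard basis vector. The sign `ε` compares `c` with
the numerator of the surgery coefficient. -/
structure SurgeryData (Γ : PlumbingGraph V) (v : V) (k : Fin (ℓ + 1) → ℤ) (p r : ℤ)
    (e : V → ℤ) (h : SurgeryVertex V ℓ → ℤ) (c : ℤ) (ε : ℤˣ) : Prop where
  kernel : Γ.B *ᵥ e = 0
  kernel_self : e v = 1
  kernel_pos : ∀ w, 0 < e w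
  pos : ∀ y, 0 < h y
  inl_eq : ∀ w, h (Sum.inl w) = h (Sum.inl v) * e w
  last_eq : h (lastVertex v ℓ) = 1
  mulVec_eq : (surgeryGraph Γ v k).B *ᵥ h = Pi.single (Sum.inl v) c
  neg : c < 0
  p_eq : p = ε * c
  r_eq : r = ε * h (Sum.inl v)

theorem exists_surgeryData (hΓ : Γ.graph.IsTree) (hambient : IsUnit (Γ.ambientB v).det)
    (hframing : Γ.B.det = 0) (hr : r ≠ 0) (hpr : IsCoprime p r)
    (hk : contFrac (List.ofFn k) = (p : ℚ) / (r : ℚ)) (hneg : (surgeryGraph Γ v k).IsNegDef) :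
    ∃ e h c ε, SurgeryData Γ v k p r e h c ε := by
  obtain ⟨e, hev, he⟩ := exists_kernel hambient hframing
  obtain ⟨u, hul, hul', hu, hcop⟩ := exists_chain_vector k
  set h : SurgeryVertex V ℓ → ℤ := Sum.elim (u 0 • e) (fun i => u (i : Fin (ℓ + 1))) with hh
  set c : ℤ := k 0 * u 0 + u 1 with hc
  have hB : (surgeryGraph Γ v k).B *ᵥ h = Pi.single (Sum.inl v) c := by
    rw [hh, surgeryGraph_mulVec _ _ (by simp [hev]), hul', Pi.single_zero, sub_zero]
    ext (x | x)
    · rw [Matrix.mulVec_smul, he]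
      simp [Pi.single_apply, hc]
    · have hx : ((x : Fin (ℓ + 1)) : ℕ) ≠ 0 := fun h => x.2 (Fin.ext h)
      simp [hu _ hx]
  have hlast : h (lastVertex v ℓ) = 1 := by
    rcases eq_or_ne ℓ 0 with hl | hl
    · rw [← (inl_eq_lastVertex v ℓ v).2 ⟨rfl, hl⟩]
      subst hl
      simp [hh, hev, hul]
    · have hne : Fin.last ℓ ≠ 0 := fun h' => hl (by simpa [Fin.ext_iff] using h')
      rw [← (inr_eq_lastVertex v ℓ ⟨Fin.last ℓ, hne⟩).2 rfl]
      simp [hh, hul]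
  -- `h` is a multiple of a column of the inverse, whose entries all have the same sign
  have hcol : ∀ y, (h y : ℝ) = c * (surgeryGraph Γ v k).Br⁻¹ y (Sum.inl v) := fun y => by
    have h1 : (surgeryGraph Γ v k).Br *ᵥ (fun y => (h y : ℝ)) = Pi.single (Sum.inl v) (c : ℝ) := by
      ext y
      rw [Br, ← intCast_mulVec, hB]
      simp [Pi.single_apply]
    have h2 : (fun y => (h y : ℝ)) =
        (surgeryGraph Γ v k).Br⁻¹ *ᵥ Pi.single (Sum.inl v) (c : ℝ) := by
      rw [← h1, Matrix.mulVec_mulVec, Matrix.nonsing_inv_mul _ hneg.det_Br_isUnit,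
        Matrix.one_mulVec]
    have h3 := congrFun h2 y
    simpa [mul_comm] using h3
  have hinv := hneg.Br_inv_neg (surgeryGraph_preconnected hΓ k)
  have hc0 : c < 0 := by
    have h1 := hcol (lastVertex v ℓ)
    rw [hlast] at h1
    have h2 := hinv (lastVertex v ℓ) (Sum.inl v)
    have : (c : ℝ) < 0 := by
      by_contra h3
      push Not at h3
      push_cast at h1
      nlinarith
    exact_mod_cast this
  have hpos : ∀ y, 0 < h y := fun y => by
    have h1 := hcol y
    have h2 : (0 : ℝ) < h y := by
      rw [h1]
      exact mul_pos_of_neg_of_neg (by exact_mod_cast hc0) (hinv _ _)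
    exact_mod_cast h2
  have hv : h (Sum.inl v) = u 0 := by simp [hh, hev]
  have hu0 : 0 < u 0 := hv ▸ hpos _
  have hcf : ((c : ℤ) : ℚ) / (u 0 : ℚ) = (p : ℚ) / r := by
    rw [← hk]
    refine (contFrac_ofFn k u hul' hu fun j hj => ?_).symm
    rcases eq_or_ne j 0 with rfl | hj0
    · exact hu0.ne'
    · have hne : (⟨j, by omega⟩ : Fin (ℓ + 1)) ≠ 0 := fun h' => hj0 (by simpa [Fin.ext_iff] using h')
      exact (hpos (Sum.inr ⟨⟨j, by omega⟩, hne⟩)).ne'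
  have hcr : c * r = p * u 0 := by
    rw [div_eq_div_iff (by exact_mod_cast hu0.ne') (by exact_mod_cast hr)] at hcf
    exact_mod_cast hcf
  have hcop' : IsCoprime c (u 0) := by
    rw [hc, add_comm, mul_comm]
    exact hcop.symm.add_mul_left_left _
  have hassoc : Associated p c := by
    refine associated_of_dvd_dvd ?_ ?_
    · exact hpr.dvd_of_dvd_mul_right ⟨u 0, hcr⟩
    · exact hcop'.dvd_of_dvd_mul_right ⟨r, hcr.symm⟩
  obtain ⟨ε, hε⟩ := hassoc
  have hp : p = ε * c := by
    rw [← hε]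
    linear_combination -p * units_mul_self ε
  refine ⟨e, h, c, ε, he, hev, fun w => ?_, hpos, fun w => ?_, hlast, hB, hc0, hp, ?_⟩
  · have h1 := hpos (Sum.inl w)
    simp only [hh, Sum.elim_inl, Pi.smul_apply, smul_eq_mul] at h1
    exact (pos_iff_pos_of_mul_pos h1).1 hu0
  · simp [hh, hev]
  · rw [hv]
    apply mul_left_cancel₀ hc0.ne
    rw [hcr, hp]
    ring

namespace SurgeryData

variable {e : V → ℤ} {h : SurgeryVertex V ℓ → ℤ} {c : ℤ} {ε : ℤˣ}

theorem dotProduct_mulVec (D : SurgeryData Γ v k p r e h c ε) (n : SurgeryVertex V ℓ → ℤ) :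
    h ⬝ᵥ ((surgeryGraph Γ v k).B *ᵥ n) = c * n (Sum.inl v) := by
  rw [Matrix.dotProduct_mulVec, ← Matrix.mulVec_transpose, B_symm, D.mulVec_eq,
    single_dotProduct]

theorem mul_inv_mulVec (D : SurgeryData Γ v k p r e h c ε)
    (hneg : (surgeryGraph Γ v k).IsNegDef) (x : SurgeryVertex V ℓ → ℤ) :
    c * ((surgeryGraph Γ v k).Bq⁻¹ *ᵥ fun w => (x w : ℚ)) (Sum.inl v) = ((h ⬝ᵥ x : ℤ) : ℚ) := by
  have h1 : (surgeryGraph Γ v k).Bq *ᵥ (fun y => (h y : ℚ)) = Pi.single (Sum.inl v) (c : ℚ) := by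
    ext y
    rw [Bq, ← intCast_mulVec, D.mulVec_eq]
    simp [Pi.single_apply]
  have h2 : (fun w => (x w : ℚ)) = (surgeryGraph Γ v k).Bq *ᵥ
      ((surgeryGraph Γ v k).Bq⁻¹ *ᵥ fun w => (x w : ℚ)) := by
    rw [Matrix.mulVec_mulVec, Matrix.mul_nonsing_inv _ hneg.det_Bq_isUnit, Matrix.one_mulVec]
  have h3 : ((h ⬝ᵥ x : ℤ) : ℚ) = (fun y => (h y : ℚ)) ⬝ᵥ (fun w => (x w : ℚ)) := by
    simp [dotProduct]
  rw [h3]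
  conv_rhs => rw [h2]
  rw [Matrix.dotProduct_mulVec, ← Matrix.mulVec_transpose, (Bq_isSymm _), h1, single_dotProduct]

theorem isLabel_iff (D : SurgeryData Γ v k p r e h c ε)
    (hneg : (surgeryGraph Γ v k).IsNegDef) (x : SurgeryVertex V ℓ → ℤ) (a : ℤ) :
    IsLabel Γ v k p x a ↔ a = ε * (h ⬝ᵥ x) := by
  have : (p : ℚ) = ε * c := by exact_mod_cast D.p_eq
  rw [IsLabel, this, mul_assoc, D.mul_inv_mulVec hneg]
  exact_mod_cast Iff.rfl

/-- The image of the linking matrix is cut out by a single congruence. -/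
theorem exists_mulVec_iff (D : SurgeryData Γ v k p r e h c ε)
    (hambient : IsUnit (Γ.ambientB v).det) (x : SurgeryVertex V ℓ → ℤ) :
    (∃ n, x = (surgeryGraph Γ v k).B *ᵥ n) ↔ p ∣ h ⬝ᵥ x := by
  have hpc : p ∣ h ⬝ᵥ x ↔ c ∣ h ⬝ᵥ x := by
    rw [D.p_eq]
    exact Units.mul_left_dvd
  rw [hpc]
  constructor
  · rintro ⟨n, rfl⟩
    exact ⟨_, D.dotProduct_mulVec n⟩
  · rintro ⟨t, ht⟩
    obtain ⟨f, hfv, hf⟩ := exists_solution hambient t (fun w => x (Sum.inl w))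
    -- solve the equations of the linear plumbing one after the other; the last one remains
    obtain ⟨u, hu0, hu1, hu⟩ := exists_two_step_recursion t
      (x (Sum.inl v) - (Γ.B *ᵥ f) v - k 0 * t)
      (fun i a b => if h : i + 1 < ℓ + 1 then
        x (Sum.inr ⟨⟨i + 1, h⟩, by simp [Fin.ext_iff]⟩) - k ⟨i + 1, h⟩ * a - b else 0)
    have hB := surgeryGraph_mulVec (Γ := Γ) (k := k) f u (by rw [hu0, hfv])
    set n : SurgeryVertex V ℓ → ℤ := Sum.elim f (fun i => u (i : Fin (ℓ + 1))) with hn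
    have hB' : (surgeryGraph Γ v k).B *ᵥ n = x - Pi.single (lastVertex v ℓ) (u (ℓ + 1)) := by
      rw [hB]
      congr 1
      ext (w | ⟨⟨i, hi⟩, hi0⟩)
      · by_cases hw : w = v
        · subst hw; simp [hu0, hu1]
        · simp [hw, hf w hw]
      · obtain ⟨i, rfl⟩ : ∃ j, i = j + 1 :=
          ⟨i - 1, by have : i ≠ 0 := fun h => hi0 (Fin.ext h); omega⟩
        simp [hu i, hi]
        ring
    have h1 := D.dotProduct_mulVec n
    rw [hB', dotProduct_sub, dotProduct_single, D.last_eq, ht] at h1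
    have h2 : n (Sum.inl v) = t := by simp [hn, hfv]
    have h3 : u (ℓ + 1) = 0 := by rw [h2] at h1; linarith
    exact ⟨n, by rw [hB', h3, Pi.single_zero, sub_zero]⟩

theorem dotProduct_surgeryGraph (f : V → ℝ) (u : Fin (ℓ + 1) → ℝ) (huv : u 0 = f v) :
    (Sum.elim f (fun i : {i : Fin (ℓ + 1) // i ≠ 0} => u i)) ⬝ᵥ ((surgeryGraph Γ v k).Br *ᵥ
      Sum.elim f (fun i : {i : Fin (ℓ + 1) // i ≠ 0} => u i)) =
      f ⬝ᵥ (Γ.Br *ᵥ f) + u ⬝ᵥ ((chain k).Br *ᵥ u) := by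
  have h1 := glue_mulVec Γ v (chain k) 0 (R := ℝ) f u huv
  have h2 : (surgeryGraph Γ v k).Br *ᵥ
      Sum.elim f (fun i : {i : Fin (ℓ + 1) // i ≠ 0} => u i) = _ := h1
  rw [h2]
  simp only [dotProduct, Fintype.sum_sum_type, Sum.elim_inl, Sum.elim_inr, mul_add,
    Finset.sum_add_distrib]
  rw [Fintype.sum_eq_add_sum_subtype_ne (fun i => u i * ((chain k).Br *ᵥ u) i) 0, huv]
  simp [Br, add_assoc]

theorem dotProduct_nonpos (hneg : (surgeryGraph Γ v k).IsNegDef) (x : SurgeryVertex V ℓ → ℝ) :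
    x ⬝ᵥ ((surgeryGraph Γ v k).Br *ᵥ x) ≤ 0 := by
  have := hneg.posSemidef.dotProduct_mulVec_nonneg x
  rw [Matrix.neg_mulVec, dotProduct_neg] at this
  simpa using this

theorem numPos_surgeryGraph (hneg : (surgeryGraph Γ v k).IsNegDef) :
    (surgeryGraph Γ v k).numPos = 0 := numPos_eq_zero _ (dotProduct_nonpos hneg)

theorem Br_mulVec_kernel (D : SurgeryData Γ v k p r e h c ε) :
    Γ.Br *ᵥ (fun w => (e w : ℝ)) = 0 := by
  ext w
  rw [Br, ← intCast_mulVec, D.kernel]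
  simp

theorem numPos_knot (D : SurgeryData Γ v k p r e h c ε)
    (hneg : (surgeryGraph Γ v k).IsNegDef) : Γ.numPos = 0 := by
  refine numPos_eq_zero _ fun x => ?_
  set y : V → ℝ := x - x v • (fun w => (e w : ℝ)) with hy
  have h1 : Γ.Br *ᵥ y = Γ.Br *ᵥ x := by
    rw [hy, Matrix.mulVec_sub, Matrix.mulVec_smul, D.Br_mulVec_kernel, smul_zero, sub_zero]
  have hsymm : Γ.Brᵀ = Γ.Br := Γ.B_symm.map _
  have h2 : (fun w => (e w : ℝ)) ⬝ᵥ (Γ.Br *ᵥ x) = 0 := by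
    rw [Matrix.dotProduct_mulVec, ← Matrix.mulVec_transpose, hsymm, D.Br_mulVec_kernel,
      zero_dotProduct]
  have h3 : y ⬝ᵥ (Γ.Br *ᵥ y) = x ⬝ᵥ (Γ.Br *ᵥ x) := by
    rw [h1, hy, sub_dotProduct, smul_dotProduct, h2, smul_zero, sub_zero]
  have h4 := dotProduct_surgeryGraph (Γ := Γ) (v := v) (k := k) y 0
    (by simp [hy, D.kernel_self])
  rw [zero_dotProduct, add_zero, h3] at h4
  exact h4 ▸ dotProduct_nonpos hneg _

theorem numPos_chain (D : SurgeryData Γ v k p r e h c ε)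
    (hneg : (surgeryGraph Γ v k).IsNegDef) : (chain k).numPos = 0 := by
  refine numPos_eq_zero _ fun u => ?_
  have h4 := dotProduct_surgeryGraph (Γ := Γ) (v := v) (k := k) (u 0 • (fun w => (e w : ℝ))) u
    (by simp [D.kernel_self])
  rw [Matrix.mulVec_smul, D.Br_mulVec_kernel, smul_zero, dotProduct_zero, zero_add] at h4
  exact h4 ▸ dotProduct_nonpos hneg _

theorem surgerySign_eq (D : SurgeryData Γ v k p r e h c ε)
    (hneg : (surgeryGraph Γ v k).IsNegDef) : surgerySign p k = ε := by
  rw [surgerySign, D.numPos_chain hneg, D.p_eq, Int.sign_mul, Int.sign_eq_neg_one_of_neg D.neg]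
  rcases Int.units_eq_one_or ε with rfl | rfl <;> simp

theorem surgeryTau_eq (D : SurgeryData Γ v k p r e h c ε)
    (hneg : (surgeryGraph Γ v k).IsNegDef) : surgeryTau Γ v k = 0 := by
  simp [surgeryTau, D.numPos_chain hneg, D.numPos_knot hneg, numPos_surgeryGraph hneg]

end SurgeryData

/-! ### Good chambers -/

theorem isGoodChamber_const {W : Type*} [Fintype W] [DecidableEq W] {Γ : PlumbingGraph W}
    (h : Γ.IsNegDef) (hc : Γ.graph.Preconnected) (σ : ℤˣ) : Γ.IsGoodChamber fun _ => σ := by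
  have hσ : (((σ : ℤˣ) : ℤ) : ℝ) * ((σ : ℤ) : ℝ) = 1 := by exact_mod_cast units_mul_self σ
  have hinv := h.Br_inv_neg hc
  refine ⟨fun x hx _ hx0 => ?_, fun i j _ _ => ?_, fun i j _ _ _ => ?_⟩
  · obtain ⟨i, hi⟩ := Function.ne_iff.1 hx0
    have hi' : 0 < x i := lt_of_le_of_ne (hx i) (Ne.symm hi)
    have hterm : ∀ a b, 0 ≤ (-(Γ.Br⁻¹ a b) * ((σ : ℤ) : ℝ) * ((σ : ℤ) : ℝ)) * x a * x b :=
      fun a b => by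
        rw [mul_assoc (-_), hσ, mul_one]
        exact mul_nonneg (mul_nonneg (by linarith [hinv a b]) (hx a)) (hx b)
    refine Finset.sum_pos' (fun a _ => Finset.sum_nonneg fun b _ => hterm a b)
      ⟨i, Finset.mem_univ _, Finset.sum_pos' (fun b _ => hterm i b) ⟨i, Finset.mem_univ _, ?_⟩⟩
    rw [mul_assoc (-_), hσ, mul_one]
    exact mul_pos (mul_pos (by linarith [hinv i i]) hi') hi'
  · rw [mul_assoc, hσ, mul_one]
    exact (hinv i j).le
  · rw [mul_assoc, hσ, mul_one]
    exact hinv i j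

theorem IsGoodChamber_eq_of_deg_eq_one {W : Type*} [Fintype W] [DecidableEq W]
    {Γ : PlumbingGraph W} (h : Γ.IsNegDef) (hc : Γ.graph.Preconnected) {α : W → ℤˣ}
    (hα : Γ.IsGoodChamber α) {i j : W} (hi : Γ.deg i = 1) (hj : Γ.deg j ≠ 2) : α j = α i := by
  have h1 := hα.2.1 i j hi hj
  have h2 := h.Br_inv_neg hc i j
  rcases Int.units_eq_one_or (α i) with h3 | h3 <;> rcases Int.units_eq_one_or (α j) with h4 | h4 <;>
    rw [h3, h4] at h1 ⊢ <;> norm_num at h1 <;> linarith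

/-- A leaf exists unless there is only one vertex. -/
theorem surgeryGraph_exists_deg_eq_one (hΓ : Γ.graph.IsTree) (k : Fin (ℓ + 1) → ℤ) :
    (∃ w, (surgeryGraph Γ v k).deg w = 1) ∨ Subsingleton (SurgeryVertex V ℓ) := by
  rcases eq_or_ne ℓ 0 with rfl | hl
  · have : IsEmpty {i : Fin (0 + 1) // i ≠ 0} := ⟨fun i => i.2 (Fin.ext (by omega))⟩
    rcases subsingleton_or_nontrivial V with hV | hV
    · right
      exact (Equiv.sumEmpty V {i : Fin (0 + 1) // i ≠ 0}).injective.subsingleton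
    · left
      obtain ⟨w, hw⟩ := Γ.exists_deg_eq_one hΓ
      refine ⟨Sum.inl w, ?_⟩
      by_cases hwv : w = v
      · subst hwv
        rw [surgeryGraph, glue_deg_inl_self, hw, chain_deg_zero k rfl]
      · rw [surgeryGraph, glue_deg_inl_of_ne _ _ _ _ _ hwv, hw]
  · left
    have hne : Fin.last ℓ ≠ 0 := fun h' => hl (by simpa [Fin.ext_iff] using h')
    exact ⟨Sum.inr ⟨Fin.last ℓ, hne⟩, by rw [surgeryGraph, glue_deg_inr, chain_deg_last k hl]⟩

theorem exists_eq_of_isGoodChamber (hΓ : Γ.graph.IsTree) (hneg : (surgeryGraph Γ v k).IsNegDef)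
    {α : SurgeryVertex V ℓ → ℤˣ} (hα : (surgeryGraph Γ v k).IsGoodChamber α) :
    ∃ σ : ℤˣ, ∀ w, (surgeryGraph Γ v k).deg w ≠ 2 → α w = σ := by
  rcases surgeryGraph_exists_deg_eq_one (v := v) hΓ k with ⟨i, hi⟩ | hs
  · exact ⟨α i, fun w hw =>
      IsGoodChamber_eq_of_deg_eq_one hneg (surgeryGraph_preconnected hΓ k) hα hi hw⟩
  · exact ⟨α (Sum.inl v), fun w _ => congrArg α (Subsingleton.elim _ _)⟩

/-! ### Shifts and the Laplace transform -/

theorem finsum_mem_fiberwise {A B M : Type*} [AddCommMonoid M] (g : A → B) {S : Set A} {D : Set B}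
    (T : A → M) (hfin : (S ∩ Function.support T).Finite) (hD : Set.MapsTo g S D) :
    ∑ᶠ b ∈ D, ∑ᶠ a ∈ {a | a ∈ S ∧ g a = b}, T a = ∑ᶠ a ∈ S, T a := by
  classical
  set s := hfin.toFinset with hs
  have hmem : ∀ a, a ∈ s ↔ a ∈ S ∧ T a ≠ 0 := fun a => by simp [hs]
  have h1 : ∀ b, ∑ᶠ a ∈ {a | a ∈ S ∧ g a = b}, T a = ∑ a ∈ s with g a = b, T a := fun b => by
    refine finsum_mem_eq_sum_of_inter_support_eq _ ?_
    ext a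
    simp only [Set.mem_inter_iff, Set.mem_ofPred_eq, Function.mem_support, Finset.coe_filter, hmem]
    tauto
  have h2 : ∑ᶠ b ∈ D, ∑ᶠ a ∈ {a | a ∈ S ∧ g a = b}, T a =
      ∑ b ∈ s.image g, ∑ a ∈ s with g a = b, T a := by
    simp only [h1]
    refine finsum_mem_eq_sum_of_subset _ ?_ ?_
    · rintro b ⟨_, hb⟩
      obtain ⟨a, ha, _⟩ := Finset.exists_ne_zero_of_sum_ne_zero hb
      rw [Finset.mem_filter] at ha
      exact Finset.mem_coe.2 (Finset.mem_image.2 ⟨a, ha⟩)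
    · intro b hb
      obtain ⟨a, ha, rfl⟩ := Finset.mem_image.1 (Finset.mem_coe.1 hb)
      exact hD ((hmem a).1 ha).1
  rw [h2, Finset.sum_fiberwise_of_maps_to fun a ha => Finset.mem_image_of_mem g ha]
  refine (finsum_mem_eq_sum_of_inter_support_eq _ ?_).symm
  ext a
  simp [hmem]

theorem yShift_nonneg (σ : ℤˣ) (s : ℕ ⊕ ℕ) : 0 ≤ (σ : ℤ) * yShift σ s := by
  rcases s with s | s
  · rw [yShift, ← mul_assoc, units_mul_self]; positivity
  · simp [yShift]

theorem zShift_nonpos (σ : ℤˣ) (s : ℕ ⊕ ℕ) : (σ : ℤ) * zShift σ s ≤ 0 := by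
  rcases s with s | s
  · simp [zShift]
  · rw [zShift, mul_neg, ← mul_assoc, units_mul_self]
    simp

theorem yShift_eq_zero_or (σ : ℤˣ) (s : ℕ ⊕ ℕ) : yShift σ s = 0 ∨ zShift σ s = 0 := by
  rcases s with s | s
  · right; rfl
  · left; rfl

theorem finite_shift_le (σ : ℤˣ) (a b : ℤ) :
    {s : ℕ ⊕ ℕ | (σ : ℤ) * yShift σ s ≤ a ∧ b ≤ (σ : ℤ) * zShift σ s}.Finite := by
  refine (((Set.finite_Iic a.toNat).image Sum.inl).union
    ((Set.finite_Iic (-b).toNat).image Sum.inr)).subset ?_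
  rintro (s | s) ⟨h1, h2⟩
  · left
    refine ⟨s, ?_, rfl⟩
    rw [yShift, ← mul_assoc, units_mul_self] at h1
    simp only [Set.mem_Iic]
    omega
  · right
    refine ⟨s, ?_, rfl⟩
    rw [zShift, mul_neg, ← mul_assoc, units_mul_self] at h2
    simp only [Set.mem_Iic]
    omega

theorem laplaceAdmissible_iff (σ : ℤˣ) (p r ε b c α β : ℤ) (s : ℕ ⊕ ℕ) :
    laplaceAdmissible σ p r ε b c α β s ↔ ShiftAdmissible σ s ∧
      p ∣ r * α + ε * yShift σ s + b ∧ p ∣ r * β + ε * zShift σ s + c := by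
  rcases s with s | s
  · have : (σ : ℤ) * ε * s = ε * (σ * s) := by ring
    simp [laplaceAdmissible, ShiftAdmissible, yShift, zShift, this]
  · have : r * β - (σ : ℤ) * ε * s = r * β + ε * -(σ * s) := by ring
    simp only [laplaceAdmissible, ShiftAdmissible, yShift, zShift, this, mul_zero, add_zero]
    tauto

theorem laplaceExponent_eq (σ : ℤˣ) (p r ε α β γ : ℤ) (s : ℕ ⊕ ℕ) :
    laplaceExponent σ p r ε α β γ s =
      γ + ((r * α * β + ε * (α * zShift σ s + β * yShift σ s) : ℤ) : ℚ) / p := by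
  rcases s with s | s
  · simp only [laplaceExponent, yShift, zShift]
    congr 3
    ring
  · simp only [laplaceExponent, yShift, zShift]
    congr 3
    ring

/-! ### The common index set of both sides -/

/-- The vector of exponents on the surgered manifold that is obtained from a lattice vector `n` of
the knot plumbing, the exponent `a` of the knot variable, and the exponent `s` of the variable of the
last vertex. -/
noncomputable def surgeryVector (Γ : PlumbingGraph V) (v : V) (ℓ : ℕ) (n : V → ℤ) (a s : ℤ) :
    SurgeryVertex V ℓ → ℤ :=
  Sum.elim (Γ.B *ᵥ n - Pi.single v a) (0 : {i : Fin (ℓ + 1) // i ≠ 0} → ℤ) - Pi.single (lastVertex v ℓ) s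

theorem surgeryVector_inl_of_ne (n : V → ℤ) (a s : ℤ) {w : V} (hw : w ≠ v) :
    surgeryVector Γ v ℓ n a s (Sum.inl w) = (Γ.B *ᵥ n) w := by
  have : (Sum.inl w : SurgeryVertex V ℓ) ≠ lastVertex v ℓ := fun h =>
    hw ((inl_eq_lastVertex v ℓ w).1 h).1
  simp [surgeryVector, hw, this]

theorem surgeryVector_inl_self (n : V → ℤ) (a s : ℤ) :
    surgeryVector Γ v ℓ n a s (Sum.inl v) = (Γ.B *ᵥ n) v - a -
      (Pi.single (lastVertex v ℓ) s : SurgeryVertex V ℓ → ℤ) (Sum.inl v) := by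
  simp [surgeryVector]

theorem surgeryVector_inr (n : V → ℤ) (a s : ℤ) (i : {i : Fin (ℓ + 1) // i ≠ 0}) :
    surgeryVector Γ v ℓ n a s (Sum.inr i) =
      -(Pi.single (lastVertex v ℓ) s : SurgeryVertex V ℓ → ℤ) (Sum.inr i) := by
  simp [surgeryVector]

/-- The index set of the surgery formula: the exponents `α, β` of the knot variables, a pair of
lattice vectors of the knot plumbing, and a shift. -/
abbrev SurgeryIndex (V : Type*) := ℤ × ℤ × ((V → ℤ) × (V → ℤ)) × (ℕ ⊕ ℕ)

/-- The pair of exponent vectors on the surgered manifold that belongs to an index. -/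
noncomputable def surgeryPair (Γ : PlumbingGraph V) (v : V) (ℓ : ℕ) (σ : ℤˣ) (x : SurgeryIndex V) :
    (SurgeryVertex V ℓ → ℤ) × (SurgeryVertex V ℓ → ℤ) :=
  (surgeryVector Γ v ℓ x.2.2.1.1 x.1 (yShift σ x.2.2.2),
    surgeryVector Γ v ℓ x.2.2.1.2 x.2.1 (zShift σ x.2.2.2))

/-- The indices that contribute to the knot series with base labels `n, m`. -/
def surgeryIndices (v : V) (σ : ℤˣ) (n m : ℤ) : Set (SurgeryIndex V) :=
  {x | x.2.2.1.1 v = n ∧ x.2.2.1.2 v = m ∧ ShiftAdmissible σ x.2.2.2}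

/-- The contribution of an index to both sides of the surgery formula. -/
noncomputable def surgeryTerm (Γ : PlumbingGraph V) (v : V) (σ : ℤˣ) (x : SurgeryIndex V) : ℤ :=
  σ * Γ.knotTerm v (fun _ => σ) x.1 x.2.1 x.2.2.1

theorem knotTerm_sign {σ : ℤˣ} {i j : ℤ} {x : (V → ℤ) × (V → ℤ)}
    (h : Γ.knotTerm v (fun _ => σ) i j x ≠ 0) :
    (0 ≤ (σ : ℤ) * (i - (Γ.B *ᵥ x.1) v) ∧ (σ : ℤ) * (j - (Γ.B *ᵥ x.2) v) ≤ 0) ∧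
      ∀ w, w ≠ v → (σ : ℤ) * (Γ.B *ᵥ x.1) w ≤ 0 ∧ 0 ≤ (σ : ℤ) * (Γ.B *ᵥ x.2) w := by
  rw [knotTerm] at h
  have h1 := left_ne_zero_of_mul h
  have h2 := right_ne_zero_of_mul h
  refine ⟨edgeCoeff_sign (right_ne_zero_of_mul h1), fun w hw => ?_⟩
  have h3 := edgeCoeff_sign (Finset.prod_ne_zero_iff.1 h2 w (by simp [hw]))
  constructor <;> linarith [h3.1, h3.2]

theorem inCone_surgeryPair {σ : ℤˣ} {x : SurgeryIndex V} (h : surgeryTerm Γ v σ x ≠ 0) :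
    InCone σ (surgeryPair Γ v ℓ σ x) := by
  obtain ⟨⟨h1, h2⟩, h3⟩ := knotTerm_sign (right_ne_zero_of_mul h)
  have hy := yShift_nonneg σ x.2.2.2
  have hz := zShift_nonpos σ x.2.2.2
  rintro (w | i)
  · by_cases hw : w = v
    · subst hw
      simp only [surgeryPair, surgeryVector_inl_self, Pi.single_apply]
      split_ifs <;> constructor <;> linarith
    · simp only [surgeryPair, surgeryVector_inl_of_ne _ _ _ hw]
      exact h3 w hw
  · simp only [surgeryPair, surgeryVector_inr, Pi.single_apply]
    split_ifs <;> constructor <;> linarith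

theorem surgeryPair_last_bound {σ : ℤˣ} {x : SurgeryIndex V} (h : surgeryTerm Γ v σ x ≠ 0) :
    (σ : ℤ) * yShift σ x.2.2.2 ≤ -(σ * (surgeryPair Γ v ℓ σ x).1 (lastVertex v ℓ)) ∧
      -(σ * (surgeryPair Γ v ℓ σ x).2 (lastVertex v ℓ)) ≤ (σ : ℤ) * zShift σ x.2.2.2 := by
  obtain ⟨⟨h1, h2⟩, h3⟩ := knotTerm_sign (right_ne_zero_of_mul h)
  rcases eq_or_ne ℓ 0 with hl | hl
  · have hlast := ((inl_eq_lastVertex v ℓ v).2 ⟨rfl, hl⟩).symm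
    simp only [surgeryPair, hlast, surgeryVector_inl_self, Pi.single_eq_same]
    constructor <;> linarith
  · have hne : Fin.last ℓ ≠ 0 := fun h' => hl (by simpa [Fin.ext_iff] using h')
    have hlast := (inr_eq_lastVertex v ℓ ⟨Fin.last ℓ, hne⟩).2 rfl
    simp only [surgeryPair, ← hlast, surgeryVector_inr]
    simp only [hlast, Pi.single_eq_same]
    constructor <;> linarith

theorem surgeryIndex_ext (hambient : IsUnit (Γ.ambientB v).det) {σ : ℤˣ} {n m : ℤ}
    {x x' : SurgeryIndex V} (hx : x ∈ surgeryIndices v σ n m) (hx' : x' ∈ surgeryIndices v σ n m)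
    (h : surgeryPair Γ v ℓ σ x = surgeryPair Γ v ℓ σ x') (hs : x.2.2.2 = x'.2.2.2) : x = x' := by
  obtain ⟨α, β, ⟨f, g⟩, s⟩ := x
  obtain ⟨α', β', ⟨f', g'⟩, s'⟩ := x'
  obtain ⟨h1, h2⟩ := Prod.ext_iff.1 h
  simp only [surgeryPair] at h1 h2
  simp only at hs
  subst hs
  have hf : f = f' := solution_unique hambient (hx.1.trans hx'.1.symm) fun w hw => by
    simpa only [surgeryVector_inl_of_ne _ _ _ hw] using congrFun h1 (Sum.inl w)
  have hg : g = g' := solution_unique hambient (hx.2.1.trans hx'.2.1.symm) fun w hw => by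
    simpa only [surgeryVector_inl_of_ne _ _ _ hw] using congrFun h2 (Sum.inl w)
  subst hf hg
  have h3 := congrFun h1 (Sum.inl v)
  have h4 := congrFun h2 (Sum.inl v)
  simp only [surgeryVector_inl_self] at h3 h4
  have h5 : α = α' := by linarith
  have h6 : β = β' := by linarith
  rw [h5, h6]

/-- The nonzero contributions with a bounded nonzero exponent of `q` are finite in number. -/
theorem finite_surgeryIndices (hΓ : Γ.graph.IsTree)
    (hambient : IsUnit (Γ.ambientB v).det) (hneg : (surgeryGraph Γ v k).IsNegDef)
    (σ : ℤˣ) (n m : ℤ) (E : ℚ) :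
    {x | x ∈ surgeryIndices v σ n m ∧ surgeryTerm Γ v σ x ≠ 0 ∧
      (surgeryGraph Γ v k).qExponent (surgeryPair Γ v ℓ σ x) ≤ E ∧
      (surgeryGraph Γ v k).qExponent (surgeryPair Γ v ℓ σ x) ≠ 0}.Finite := by
  have hfin := hneg.finite_qExponent_le (surgeryGraph_preconnected hΓ k) σ E
  refine Set.Finite.of_injOn (f := fun x => (surgeryPair Γ v ℓ σ x, x.2.2.2)) ?_ ?_
    (hfin.biUnion fun l _ => (finite_shift_le σ (-(σ * l.1 (lastVertex v ℓ)))
      (-(σ * l.2 (lastVertex v ℓ)))).image (Prod.mk l))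
  · rintro x ⟨_, hT, hE, hne⟩
    refine Set.mem_biUnion (⟨inCone_surgeryPair hT, hE, hne⟩ : _ ∧ _) ?_
    exact ⟨x.2.2.2, surgeryPair_last_bound hT, rfl⟩
  · rintro x ⟨hx, _⟩ y ⟨hy, _⟩ hxy
    obtain ⟨h1, h2⟩ := Prod.ext_iff.1 hxy
    exact surgeryIndex_ext hambient hx hy h1 h2

/-- Integrating out the variables of the linear plumbing: only one shift remains, and it is
attached to the last vertex. -/
theorem edgeCoeff_mul_prod_chain (σ : ℤˣ)
    (l : (SurgeryVertex V ℓ → ℤ) × (SurgeryVertex V ℓ → ℤ)) :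
    edgeCoeff σ (2 - ((surgeryGraph Γ v k).deg (Sum.inl v) : ℤ)) (-(l.1 (Sum.inl v)))
        (-(l.2 (Sum.inl v))) *
      ∏ i : {i : Fin (ℓ + 1) // i ≠ 0}, edgeCoeff σ (2 - ((surgeryGraph Γ v k).deg (Sum.inr i) : ℤ))
        (-(l.1 (Sum.inr i))) (-(l.2 (Sum.inr i))) =
    ∑ᶠ s ∈ {s | ShiftAdmissible σ s ∧
        (∀ i, l.1 (Sum.inr i) =
          -(Pi.single (lastVertex v ℓ) (yShift σ s) : SurgeryVertex V ℓ → ℤ) (Sum.inr i)) ∧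
        (∀ i, l.2 (Sum.inr i) =
          -(Pi.single (lastVertex v ℓ) (zShift σ s) : SurgeryVertex V ℓ → ℤ) (Sum.inr i))},
      (σ : ℤ) * edgeCoeff σ (1 - (Γ.deg v : ℤ))
        (-(l.1 (Sum.inl v)) -
          (Pi.single (lastVertex v ℓ) (yShift σ s) : SurgeryVertex V ℓ → ℤ) (Sum.inl v))
        (-(l.2 (Sum.inl v)) -
          (Pi.single (lastVertex v ℓ) (zShift σ s) : SurgeryVertex V ℓ → ℤ) (Sum.inl v)) := by
  rcases eq_or_ne ℓ 0 with rfl | hl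
  · have hem : IsEmpty {i : Fin (0 + 1) // i ≠ 0} := ⟨fun i => i.2 (Fin.ext (by omega))⟩
    have hd : (2 : ℤ) - ((surgeryGraph Γ v k).deg (Sum.inl v) : ℤ) = 1 - (Γ.deg v : ℤ) + 1 := by
      rw [surgeryGraph, glue_deg_inl_self, chain_deg_zero k rfl]
      push_cast; ring
    rw [hd, edgeCoeff_add_one, Fintype.prod_empty, mul_one]
    have hlast := (inl_eq_lastVertex v 0 v).2 ⟨rfl, rfl⟩
    simp only [Pi.single_apply, hlast, if_true]
    refine finsum_mem_congr ?_ fun s _ => rfl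
    ext s
    simp
  · have hne : Fin.last ℓ ≠ 0 := fun h' => hl (by simpa [Fin.ext_iff] using h')
    set last : {i : Fin (ℓ + 1) // i ≠ 0} := ⟨Fin.last ℓ, hne⟩ with hlast
    have hd : (2 : ℤ) - ((surgeryGraph Γ v k).deg (Sum.inl v) : ℤ) = 1 - (Γ.deg v : ℤ) := by
      rw [surgeryGraph, glue_deg_inl_self, chain_deg_first k hl]
      push_cast; ring
    have hlv : ∀ i : {i : Fin (ℓ + 1) // i ≠ 0},
        (Sum.inr i : SurgeryVertex V ℓ) = lastVertex v ℓ ↔ i = last := fun i => by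
      rw [inr_eq_lastVertex, hlast, Subtype.ext_iff]
    have hdl : (2 : ℤ) - ((surgeryGraph Γ v k).deg (Sum.inr last) : ℤ) = 0 + 1 := by
      rw [surgeryGraph, glue_deg_inr, hlast, chain_deg_last k hl]
      norm_num
    have hdm : ∀ i, i ≠ last →
        (2 : ℤ) - ((surgeryGraph Γ v k).deg (Sum.inr i) : ℤ) = 0 := fun i hi => by
      rw [surgeryGraph, glue_deg_inr, chain_deg_middle k i i.2 fun h => hi (Subtype.ext h)]
      norm_num
    have hinl : (Sum.inl v : SurgeryVertex V ℓ) ≠ lastVertex v ℓ := fun h =>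
      hl ((inl_eq_lastVertex v ℓ v).1 h).2
    rw [hd, ← Finset.mul_prod_erase _ _ (Finset.mem_univ last), hdl, edgeCoeff_add_one]
    have hprod : ∏ i ∈ Finset.univ.erase last,
        edgeCoeff σ (2 - ((surgeryGraph Γ v k).deg (Sum.inr i) : ℤ))
          (-(l.1 (Sum.inr i))) (-(l.2 (Sum.inr i))) =
        ∏ i ∈ Finset.univ.erase last, if l.1 (Sum.inr i) = 0 ∧ l.2 (Sum.inr i) = 0 then 1 else 0 :=
      Finset.prod_congr rfl fun i hi => by
        rw [hdm i (Finset.ne_of_mem_erase hi), edgeCoeff_zero]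
        simp
    rw [hprod]
    by_cases hz : ∀ i, i ≠ last → l.1 (Sum.inr i) = 0 ∧ l.2 (Sum.inr i) = 0
    · rw [Finset.prod_eq_one fun i hi => if_pos (hz i (Finset.ne_of_mem_erase hi)), mul_one,
        mul_finsum_mem]
      refine finsum_congr fun s => ?_
      have hiff : (ShiftAdmissible σ s ∧
          (∀ i, l.1 (Sum.inr i) =
            -(Pi.single (lastVertex v ℓ) (yShift σ s) : SurgeryVertex V ℓ → ℤ) (Sum.inr i)) ∧
          (∀ i, l.2 (Sum.inr i) =
            -(Pi.single (lastVertex v ℓ) (zShift σ s) : SurgeryVertex V ℓ → ℤ) (Sum.inr i))) ↔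
          ShiftAdmissible σ s ∧ l.1 (Sum.inr last) = -yShift σ s ∧
            l.2 (Sum.inr last) = -zShift σ s := by
        refine and_congr_right fun _ => and_congr ?_ ?_
        · constructor
          · intro h
            simpa [Pi.single_apply, (hlv last).2 rfl] using h last
          · intro h i
            by_cases hi : i = last
            · subst hi; simpa [Pi.single_apply, (hlv last).2 rfl] using h
            · simp [hlv, hi, (hz i hi).1]
        · constructor
          · intro h
            simpa [Pi.single_apply, (hlv last).2 rfl] using h last
          · intro h i
            by_cases hi : i = last
            · subst hi; simpa [Pi.single_apply, (hlv last).2 rfl] using h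
            · simp [hlv, hi, (hz i hi).2]
      have hinl0 : ∀ t, (Pi.single (lastVertex v ℓ) t : SurgeryVertex V ℓ → ℤ) (Sum.inl v) = 0 :=
        fun t => by simp [hinl]
      simp only [Set.mem_ofPred_eq, hiff, hinl0, sub_zero, edgeCoeff_zero]
      have h1 : -(l.1 (Sum.inr last)) - yShift σ s = 0 ↔ l.1 (Sum.inr last) = -yShift σ s := by
        constructor <;> intro <;> linarith
      have h2 : -(l.2 (Sum.inr last)) - zShift σ s = 0 ↔ l.2 (Sum.inr last) = -zShift σ s := by
        constructor <;> intro <;> linarith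
      simp only [h1, h2]
      by_cases hs : ShiftAdmissible σ s <;>
        by_cases ha : l.1 (Sum.inr last) = -yShift σ s ∧ l.2 (Sum.inr last) = -zShift σ s
      · simp [hs, ha, mul_comm]
      · simp [hs, ha]
      · simp [hs]
      · simp [hs]
    · push Not at hz
      obtain ⟨i, hi, hi'⟩ := hz
      rw [Finset.prod_eq_zero (i := i) (by simp [hi]) (if_neg fun h => hi' h.1 h.2), mul_zero,
        mul_zero]
      symm
      have hem : ∀ s, ¬ (ShiftAdmissible σ s ∧
          (∀ i, l.1 (Sum.inr i) =
            -(Pi.single (lastVertex v ℓ) (yShift σ s) : SurgeryVertex V ℓ → ℤ) (Sum.inr i)) ∧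
          (∀ i, l.2 (Sum.inr i) =
            -(Pi.single (lastVertex v ℓ) (zShift σ s) : SurgeryVertex V ℓ → ℤ) (Sum.inr i))) := by
        rintro s ⟨_, h1, h2⟩
        have h1' := h1 i
        have h2' := h2 i
        simp [hlv, hi] at h1' h2'
        exact hi' h1' h2'
      exact finsum_mem_eq_zero_of_forall_eq_zero fun s hs => (hem s hs).elim

namespace SurgeryData

variable {e : V → ℤ} {h : SurgeryVertex V ℓ → ℤ} {c : ℤ} {ε : ℤˣ}

theorem kernel_dotProduct (D : SurgeryData Γ v k p r e h c ε) (n : V → ℤ) :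
    e ⬝ᵥ (Γ.B *ᵥ n) = 0 := by
  rw [Matrix.dotProduct_mulVec, ← Matrix.mulVec_transpose, B_symm, D.kernel, zero_dotProduct]

theorem dotProduct_surgeryVector (D : SurgeryData Γ v k p r e h c ε) (n : V → ℤ) (a s : ℤ) :
    h ⬝ᵥ surgeryVector Γ v ℓ n a s = -(h (Sum.inl v) * a + s) := by
  have h1 : h ⬝ᵥ Sum.elim (Γ.B *ᵥ n - Pi.single v a) 0 = -(h (Sum.inl v) * a) := by
    have : h = Sum.elim (h (Sum.inl v) • e) (fun i => h (Sum.inr i)) := by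
      ext (w | i)
      · exact D.inl_eq w
      · rfl
    conv_lhs => rw [this]
    rw [sumElim_dotProduct_sumElim, dotProduct_zero, add_zero, smul_dotProduct, dotProduct_sub,
      D.kernel_dotProduct, dotProduct_single, D.kernel_self]
    simp
  rw [surgeryVector, dotProduct_sub, h1, dotProduct_single, D.last_eq]
  ring

/-- The exponent of `q` on the surgered manifold, when the shift sits in the second vector. -/
theorem qExponent_surgeryVector (D : SurgeryData Γ v k p r e h c ε)
    (hneg : (surgeryGraph Γ v k).IsNegDef) (n m : V → ℤ) (a b t : ℤ) :
    (surgeryGraph Γ v k).qExponent (surgeryVector Γ v ℓ n a 0, surgeryVector Γ v ℓ m b t) =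
      ((n ⬝ᵥ (Γ.B *ᵥ m) : ℤ) : ℚ) + ((a * (h (Sum.inl v) * b + t) : ℤ) : ℚ) / c := by
  -- after a shift by the kernel, `n` vanishes at the glued vertex and extends by zero
  set n' : V → ℤ := n - n v • e with hn'
  have hn'v : n' v = 0 := by simp [hn', D.kernel_self]
  have hBn' : Γ.B *ᵥ n' = Γ.B *ᵥ n := by
    rw [hn', Matrix.mulVec_sub, Matrix.mulVec_smul, D.kernel, smul_zero, sub_zero]
  set ι : SurgeryVertex V ℓ → ℤ := Sum.elim n' 0 with hι
  set l₂ := surgeryVector Γ v ℓ m b t with hl₂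
  have hBι : (surgeryGraph Γ v k).B *ᵥ ι = Sum.elim (Γ.B *ᵥ n) 0 := by
    have h1 := surgeryGraph_mulVec (Γ := Γ) (v := v) (k := k) n' (fun _ => 0) hn'v.symm
    refine h1.trans ?_
    rw [hBn']
    ext (w | i) <;> simp
  have hl₁ : surgeryVector Γ v ℓ n a 0 =
      (surgeryGraph Γ v k).B *ᵥ ι - Pi.single (Sum.inl v) a := by
    rw [hBι, surgeryVector]
    ext (w | i) <;> simp [Pi.single_apply]
  have hcast : (fun w => (surgeryVector Γ v ℓ n a 0 w : ℚ)) =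
      (surgeryGraph Γ v k).Bq *ᵥ (fun w => (ι w : ℚ)) - Pi.single (Sum.inl v) (a : ℚ) := by
    ext w
    rw [hl₁, Pi.sub_apply, Pi.sub_apply, Bq, ← intCast_mulVec]
    simp [Pi.single_apply]
  have hlast : ι (lastVertex v ℓ) = 0 := by
    rcases hv : lastVertex v ℓ with w | i
    · have := ((inl_eq_lastVertex v ℓ w).1 hv.symm).1
      rw [this, hι, Sum.elim_inl, hn'v]
    · rfl
  have hι₂ : ι ⬝ᵥ l₂ = n ⬝ᵥ (Γ.B *ᵥ m) := by
    rw [hl₂, surgeryVector, dotProduct_sub, dotProduct_single, hlast, zero_mul, sub_zero, hι,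
      sumElim_dotProduct_sumElim, dotProduct_sub, dotProduct_single, hn'v, hn', sub_dotProduct,
      smul_dotProduct, D.kernel_dotProduct]
    simp
  have hc : (c : ℚ) ≠ 0 := by exact_mod_cast D.neg.ne
  have hv := D.mul_inv_mulVec hneg l₂
  rw [hl₂, D.dotProduct_surgeryVector, ← hl₂] at hv
  have hmain : (surgeryGraph Γ v k).qExponent (surgeryVector Γ v ℓ n a 0, l₂) =
      (fun w => (ι w : ℚ)) ⬝ᵥ (fun w => (l₂ w : ℚ)) -
        a * ((surgeryGraph Γ v k).Bq⁻¹ *ᵥ fun w => (l₂ w : ℚ)) (Sum.inl v) := by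
    rw [qExponent]
    simp only
    rw [hcast, sub_dotProduct, single_dotProduct]
    congr 1
    rw [Matrix.dotProduct_mulVec, ← Matrix.mulVec_transpose, Matrix.transpose_nonsing_inv,
      Bq_isSymm, Matrix.mulVec_mulVec, Matrix.nonsing_inv_mul _ hneg.det_Bq_isUnit,
      Matrix.one_mulVec]
  rw [hmain, ← hι₂]
  have h3 : ((ι ⬝ᵥ l₂ : ℤ) : ℚ) = (fun y => (ι y : ℚ)) ⬝ᵥ (fun w => (l₂ w : ℚ)) := by
    simp [dotProduct]
  rw [h3, sub_eq_add_neg]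
  congr 1
  rw [eq_div_iff hc]
  push_cast at hv ⊢
  linear_combination -(a : ℚ) * hv

theorem qExponent_surgeryPair (D : SurgeryData Γ v k p r e h c ε)
    (hneg : (surgeryGraph Γ v k).IsNegDef) (σ : ℤˣ) (x : SurgeryIndex V) :
    (surgeryGraph Γ v k).qExponent (surgeryPair Γ v ℓ σ x) =
      laplaceExponent σ p r ε x.1 x.2.1 (x.2.2.1.1 ⬝ᵥ (Γ.B *ᵥ x.2.2.1.2)) x.2.2.2 := by
  obtain ⟨α, β, ⟨f, g⟩, s⟩ := x
  rw [laplaceExponent_eq, surgeryPair]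
  simp only
  have hε : (ε : ℤ) ≠ 0 := ε.ne_zero
  have hdiv : ∀ a : ℤ, ((ε * a : ℤ) : ℚ) / p = (a : ℚ) / c := fun a => by
    rw [D.p_eq]
    push_cast
    exact mul_div_mul_left _ _ (by exact_mod_cast hε)
  have hr : r * α * β + ε * (α * zShift σ s + β * yShift σ s) =
      ε * (h (Sum.inl v) * α * β + (α * zShift σ s + β * yShift σ s)) := by
    rw [D.r_eq]; ring
  rw [hr, hdiv]
  rcases yShift_eq_zero_or σ s with hs | hs
  · rw [hs, D.qExponent_surgeryVector hneg]
    congr 3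
    ring
  · rw [hs, qExponent_swap, D.qExponent_surgeryVector hneg]
    congr 1
    · rw [Matrix.dotProduct_mulVec, ← Matrix.mulVec_transpose, B_symm, dotProduct_comm]
    · congr 2
      ring

theorem exists_mulVec_add_iff (D : SurgeryData Γ v k p r e h c ε)
    (hambient : IsUnit (Γ.ambientB v).det) (hneg : (surgeryGraph Γ v k).IsNegDef)
    {bv : SurgeryVertex V ℓ → ℤ} {b : ℤ} (hb : IsLabel Γ v k p bv b) (n : V → ℤ) (a s : ℤ) :
    (∃ x, surgeryVector Γ v ℓ n a s = (surgeryGraph Γ v k).B *ᵥ x + bv) ↔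
      p ∣ r * a + ε * s + b := by
  have h1 : (∃ x, surgeryVector Γ v ℓ n a s = (surgeryGraph Γ v k).B *ᵥ x + bv) ↔
      ∃ x, surgeryVector Γ v ℓ n a s - bv = (surgeryGraph Γ v k).B *ᵥ x := by
    simp only [sub_eq_iff_eq_add]
  have h2 : r * a + ε * s + b = (-ε : ℤˣ) * (h ⬝ᵥ (surgeryVector Γ v ℓ n a s - bv)) := by
    rw [(D.isLabel_iff hneg bv b).1 hb, dotProduct_sub, D.dotProduct_surgeryVector, D.r_eq,
      Units.val_neg]
    ring
  rw [h1, D.exists_mulVec_iff hambient, h2]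
  exact (Units.dvd_mul_left).symm

theorem surgeryPair_mem_latticePairs_iff (D : SurgeryData Γ v k p r e h c ε)
    (hambient : IsUnit (Γ.ambientB v).det) (hneg : (surgeryGraph Γ v k).IsNegDef)
    {bv cv : SurgeryVertex V ℓ → ℤ} {b b' : ℤ} (hb : IsLabel Γ v k p bv b)
    (hb' : IsLabel Γ v k p cv b') {σ : ℤˣ} {x : SurgeryIndex V}
    (hs : ShiftAdmissible σ x.2.2.2) :
    surgeryPair Γ v ℓ σ x ∈ (surgeryGraph Γ v k).latticePairs bv cv ↔
      laplaceAdmissible σ p r ε b b' x.1 x.2.1 x.2.2.2 := by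
  rw [laplaceAdmissible_iff]
  simp only [hs, true_and]
  exact and_congr (D.exists_mulVec_add_iff hambient hneg hb _ _ _)
    (D.exists_mulVec_add_iff hambient hneg hb' _ _ _)

/-- If the labels are nontrivial, the exponents of `q` do not vanish. -/
theorem qExponent_ne_zero_of_label (D : SurgeryData Γ v k p r e h c ε) (hΓ : Γ.graph.IsTree)
    (hneg : (surgeryGraph Γ v k).IsNegDef)
    {bv cv : SurgeryVertex V ℓ → ℤ} {b b' : ℤ} (hb : IsLabel Γ v k p bv b)
    (hb' : IsLabel Γ v k p cv b') (hpb : ¬ p ∣ b) (hpb' : ¬ p ∣ b') {σ : ℤˣ}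
    {l : (SurgeryVertex V ℓ → ℤ) × (SurgeryVertex V ℓ → ℤ)} (hl : InCone σ l)
    (hmem : l ∈ (surgeryGraph Γ v k).latticePairs bv cv) :
    (surgeryGraph Γ v k).qExponent l ≠ 0 := by
  have key : ∀ {x y : SurgeryVertex V ℓ → ℤ} {a : ℤ}, IsLabel Γ v k p y a → ¬ p ∣ a →
      (∃ n, x = (surgeryGraph Γ v k).B *ᵥ n + y) → x ≠ 0 := by
    rintro _ y a ha hpa ⟨n, rfl⟩ h0
    apply hpa
    have h1 := congrArg (fun z => h ⬝ᵥ z) h0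
    simp only [dotProduct_add, D.dotProduct_mulVec, dotProduct_zero] at h1
    rw [(D.isLabel_iff hneg y a).1 ha, D.p_eq]
    exact ⟨-n (Sum.inl v), by linear_combination (ε : ℤ) * h1⟩
  exact hneg.qExponent_ne_zero (surgeryGraph_preconnected hΓ k) hl (key hb hpb hmem.1)
    (key hb' hpb' hmem.2)

/-- The term of the surgered manifold is the sum of the contributions of the indices over it. -/
theorem closedTerm_eq_finsum (D : SurgeryData Γ v k p r e h c ε)
    (hambient : IsUnit (Γ.ambientB v).det) (hneg : (surgeryGraph Γ v k).IsNegDef)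
    (σ : ℤˣ) (n m : ℤ) (l : (SurgeryVertex V ℓ → ℤ) × (SurgeryVertex V ℓ → ℤ)) :
    (surgeryGraph Γ v k).closedTerm (fun _ => σ) l =
      ∑ᶠ x ∈ {x | x ∈ surgeryIndices v σ n m ∧ surgeryPair Γ v ℓ σ x = l},
        surgeryTerm Γ v σ x := by
  obtain ⟨f, hfv, hf⟩ := exists_solution hambient n (fun w => l.1 (Sum.inl w))
  obtain ⟨g, hgv, hg⟩ := exists_solution hambient m (fun w => l.2 (Sum.inl w))
  set P : ℤ := ∏ w ∈ Finset.univ.erase v,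
    edgeCoeff σ (2 - (Γ.deg w : ℤ)) (-(l.1 (Sum.inl w))) (-(l.2 (Sum.inl w))) with hP
  have hlhs : (surgeryGraph Γ v k).closedTerm (fun _ => σ) l =
      (edgeCoeff σ (2 - ((surgeryGraph Γ v k).deg (Sum.inl v) : ℤ)) (-(l.1 (Sum.inl v)))
        (-(l.2 (Sum.inl v))) *
      ∏ i : {i : Fin (ℓ + 1) // i ≠ 0}, edgeCoeff σ (2 - ((surgeryGraph Γ v k).deg (Sum.inr i) : ℤ))
        (-(l.1 (Sum.inr i))) (-(l.2 (Sum.inr i)))) * P := by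
    rw [closedTerm, numPos_surgeryGraph hneg, pow_zero, one_mul, Fintype.prod_sum_type,
      ← Finset.mul_prod_erase _ _ (Finset.mem_univ v)]
    have : ∏ w ∈ Finset.univ.erase v,
        edgeCoeff σ (2 - ((surgeryGraph Γ v k).deg (Sum.inl w) : ℤ)) (-(l.1 (Sum.inl w)))
          (-(l.2 (Sum.inl w))) = P :=
      Finset.prod_congr rfl fun w hw => by
        rw [surgeryGraph, glue_deg_inl_of_ne _ _ _ _ _ (Finset.ne_of_mem_erase hw)]
    rw [this]
    ring
  rw [hlhs, edgeCoeff_mul_prod_chain, finsum_mem_mul]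
  refine finsum_mem_eq_of_bijOn
    (fun s => ((Γ.B *ᵥ f) v - l.1 (Sum.inl v) -
        (Pi.single (lastVertex v ℓ) (yShift σ s) : SurgeryVertex V ℓ → ℤ) (Sum.inl v),
      (Γ.B *ᵥ g) v - l.2 (Sum.inl v) -
        (Pi.single (lastVertex v ℓ) (zShift σ s) : SurgeryVertex V ℓ → ℤ) (Sum.inl v),
      (f, g), s)) ⟨?_, ?_, ?_⟩ ?_
  · rintro s ⟨hs, h1, h2⟩
    refine ⟨⟨hfv, hgv, hs⟩, Prod.ext ?_ ?_⟩
    · ext (w | i)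
      · by_cases hw : w = v
        · subst hw
          simp only [surgeryPair, surgeryVector_inl_self]
          ring
        · simp only [surgeryPair, surgeryVector_inl_of_ne _ _ _ hw, hf w hw]
      · simp only [surgeryPair, surgeryVector_inr, h1]
    · ext (w | i)
      · by_cases hw : w = v
        · subst hw
          simp only [surgeryPair, surgeryVector_inl_self]
          ring
        · simp only [surgeryPair, surgeryVector_inl_of_ne _ _ _ hw, hg w hw]
      · simp only [surgeryPair, surgeryVector_inr, h2]
  · intro s _ t _ hst
    exact (congrArg (fun x : SurgeryIndex V => x.2.2.2) hst)
  · rintro ⟨α, β, ⟨f', g'⟩, s⟩ ⟨hx, rfl⟩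
    have hf' : f = f' := solution_unique hambient (hfv.trans hx.1.symm) fun w hw => by
      rw [hf w hw]
      simp only [surgeryPair, surgeryVector_inl_of_ne _ _ _ hw]
    have hg' : g = g' := solution_unique hambient (hgv.trans hx.2.1.symm) fun w hw => by
      rw [hg w hw]
      simp only [surgeryPair, surgeryVector_inl_of_ne _ _ _ hw]
    subst hf' hg'
    refine ⟨s, ⟨hx.2.2, fun i => surgeryVector_inr _ _ _ i, fun i => surgeryVector_inr _ _ _ i⟩, ?_⟩
    simp only [surgeryPair, surgeryVector_inl_self, Prod.mk.injEq, and_true]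
    constructor <;> ring
  · rintro s ⟨hs, h1, h2⟩
    simp only [surgeryTerm, knotTerm, D.numPos_knot hneg, pow_zero, one_mul]
    have hPk : ∏ w ∈ Finset.univ.erase v, edgeCoeff σ (2 - (Γ.deg w : ℤ)) (-((Γ.B *ᵥ f) w))
        (-((Γ.B *ᵥ g) w)) = P :=
      Finset.prod_congr rfl fun w hw => by
        rw [hf w (Finset.ne_of_mem_erase hw), hg w (Finset.ne_of_mem_erase hw)]
    rw [hPk, mul_assoc]
    congr 3 <;> ring

/-- Each coefficient of a monomial in the series of the knot complement is a finite sum: the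
positive kernel vector bounds the exponents. -/
theorem finite_knotSupport (D : SurgeryData Γ v k p r e h c ε)
    (hambient : IsUnit (Γ.ambientB v).det) (σ : ℤˣ) (n m i j : ℤ) :
    (Γ.knotSupport v (fun _ => σ) n m i j).Finite := by
  have hbound : ∀ (τ : ℤˣ) (a : ℤ) (f : V → ℤ), 0 ≤ (τ : ℤ) * (a - (Γ.B *ᵥ f) v) →
      (∀ w, w ≠ v → (τ : ℤ) * (Γ.B *ᵥ f) w ≤ 0) →
      ∀ w, w ≠ v → |(Γ.B *ᵥ f) w| ≤ |a| := by
    intro τ a f hv hne w hw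
    have h1 := D.kernel_dotProduct f
    have h2 : e ⬝ᵥ (fun u => (τ : ℤ) * ((Pi.single v a : V → ℤ) u - (Γ.B *ᵥ f) u)) = τ * a := by
      have : (fun u => (τ : ℤ) * ((Pi.single v a : V → ℤ) u - (Γ.B *ᵥ f) u)) =
          (τ : ℤ) • (Pi.single v a - Γ.B *ᵥ f) := rfl
      rw [this, dotProduct_smul, dotProduct_sub, h1, dotProduct_single, D.kernel_self]
      simp
    have hnn : ∀ u, 0 ≤ (τ : ℤ) * ((Pi.single v a : V → ℤ) u - (Γ.B *ᵥ f) u) := fun u => by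
      by_cases hu : u = v
      · subst hu; simpa using hv
      · simp only [Pi.single_apply, hu, if_false]
        linarith [hne u hu]
    have h3 : e w * ((τ : ℤ) * ((Pi.single v a : V → ℤ) w - (Γ.B *ᵥ f) w)) ≤ τ * a := by
      rw [← h2]
      exact Finset.single_le_sum
        (f := fun u => e u * ((τ : ℤ) * ((Pi.single v a : V → ℤ) u - (Γ.B *ᵥ f) u)))
        (fun u _ => mul_nonneg (D.kernel_pos u).le (hnn u)) (Finset.mem_univ w)
    have h4 := hnn w
    simp only [Pi.single_apply, hw, if_false] at h3 h4
    have h5 : (τ : ℤ) * (0 - (Γ.B *ᵥ f) w) ≤ τ * a := by nlinarith [D.kernel_pos w]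
    have h6 : ∀ z : ℤ, |(τ : ℤ) * z| = |z| := fun z => by
      rcases Int.units_eq_one_or τ with rfl | rfl <;> simp
    have h7 : |(τ : ℤ) * (0 - (Γ.B *ᵥ f) w)| ≤ |(τ : ℤ) * a| := by
      rw [abs_of_nonneg h4]
      exact h5.trans (le_abs_self _)
    rwa [h6, h6, zero_sub, abs_neg] at h7
  let F : ((V → ℤ) × (V → ℤ)) → ((V → ℤ) × (V → ℤ)) := fun x =>
    (fun w => if w = v then 0 else (Γ.B *ᵥ x.1) w, fun w => if w = v then 0 else (Γ.B *ᵥ x.2) w)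
  refine Set.Finite.of_injOn (f := F)
    (t := Set.Icc (fun _ => -|i|) (fun _ => |i|) ×ˢ Set.Icc (fun _ => -|j|) (fun _ => |j|))
    ?_ ?_ ((Set.finite_Icc _ _).prod (Set.finite_Icc _ _))
  · rintro x ⟨_, _, hx⟩
    obtain ⟨⟨h1, h2⟩, h3⟩ := knotTerm_sign hx
    have hi : ∀ w, |(F x).1 w| ≤ |i| := fun w => by
      by_cases hw : w = v
      · simp [F, hw]
      · simp only [F, hw, if_false]
        exact hbound σ i x.1 h1 (fun u hu => (h3 u hu).1) w hw
    have hj : ∀ w, |(F x).2 w| ≤ |j| := fun w => by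
      by_cases hw : w = v
      · simp [F, hw]
      · simp only [F, hw, if_false]
        refine hbound (-σ) j x.2 ?_ (fun u hu => ?_) w hw
        · rw [Units.val_neg]; linarith
        · rw [Units.val_neg]; linarith [(h3 u hu).2]
    exact ⟨⟨fun w => (abs_le.1 (hi w)).1, fun w => (abs_le.1 (hi w)).2⟩,
      ⟨fun w => (abs_le.1 (hj w)).1, fun w => (abs_le.1 (hj w)).2⟩⟩
  · rintro x ⟨hx1, hx2, _⟩ y ⟨hy1, hy2, _⟩ hxy
    obtain ⟨h1, h2⟩ := Prod.ext_iff.1 hxy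
    refine Prod.ext (solution_unique hambient (hx1.trans hy1.symm) fun w hw => ?_)
      (solution_unique hambient (hx2.trans hy2.symm) fun w hw => ?_)
    · simpa [F, hw] using congrFun h1 w
    · simpa [F, hw] using congrFun h2 w

/-- Both sides of the surgery formula are rearrangements of one family of contributions. -/
theorem zhatCoeff_eq_laplaceCoeff (D : SurgeryData Γ v k p r e h c ε)
    (hambient : IsUnit (Γ.ambientB v).det) (hneg : (surgeryGraph Γ v k).IsNegDef)
    {bv cv : SurgeryVertex V ℓ → ℤ} {b b' : ℤ} (hb : IsLabel Γ v k p bv b)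
    (hb' : IsLabel Γ v k p cv b') (σ : ℤˣ) (n m : ℤ) (E : ℚ)
    (hfin : {x | x ∈ surgeryIndices v σ n m ∧ surgeryTerm Γ v σ x ≠ 0 ∧
      surgeryPair Γ v ℓ σ x ∈ (surgeryGraph Γ v k).latticePairs bv cv ∧
      (surgeryGraph Γ v k).qExponent (surgeryPair Γ v ℓ σ x) = E}.Finite) :
    (surgeryGraph Γ v k).zhatCoeff (fun _ => σ) bv cv E =
      laplaceCoeff σ p r ε b b' (Γ.knotCoeff v (fun _ => σ) n m) E := by
  set S : Set (SurgeryIndex V) := {x | x ∈ surgeryIndices v σ n m ∧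
    surgeryPair Γ v ℓ σ x ∈ (surgeryGraph Γ v k).latticePairs bv cv ∧
    (surgeryGraph Γ v k).qExponent (surgeryPair Γ v ℓ σ x) = E} with hS
  have hSfin : (S ∩ Function.support (surgeryTerm Γ v σ)).Finite := by
    refine hfin.subset ?_
    rintro x ⟨⟨h1, h2, h3⟩, h4⟩
    exact ⟨h1, h4, h2, h3⟩
  have hleft : (surgeryGraph Γ v k).zhatCoeff (fun _ => σ) bv cv E =
      ∑ᶠ x ∈ S, surgeryTerm Γ v σ x := by
    rw [← finsum_mem_fiberwise (surgeryPair Γ v ℓ σ) (D := {l |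
      l ∈ (surgeryGraph Γ v k).latticePairs bv cv ∧ (surgeryGraph Γ v k).qExponent l = E})
      _ hSfin fun x hx => hx.2, zhatCoeff]
    refine finsum_congr fun l => ?_
    by_cases hl : l ∈ (surgeryGraph Γ v k).latticePairs bv cv ∧
      (surgeryGraph Γ v k).qExponent l = E
    · have h1 : (surgeryGraph Γ v k).closedTerm (fun _ => σ) l =
          ∑ᶠ x ∈ {x | x ∈ S ∧ surgeryPair Γ v ℓ σ x = l}, surgeryTerm Γ v σ x := by
        rw [D.closedTerm_eq_finsum hambient hneg σ n m l]
        refine finsum_mem_congr ?_ fun _ _ => rfl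
        ext x
        constructor
        · rintro ⟨hx, rfl⟩
          exact ⟨⟨hx, hl⟩, rfl⟩
        · rintro ⟨hx, rfl⟩
          exact ⟨hx.1, rfl⟩
      have hl' : l ∈ {l | l ∈ (surgeryGraph Γ v k).latticePairs bv cv ∧
        (surgeryGraph Γ v k).qExponent l = E} := hl
      classical
      rw [finsum_eq_if, finsum_eq_if, if_pos hl', ← h1]
      split_ifs with h0
      · rfl
      · by_contra h2
        exact h0 ⟨⟨hl.1, Ne.symm h2⟩, hl.2⟩
    · have h2 : ¬ (l ∈ (surgeryGraph Γ v k).zhatSupport (fun _ => σ) bv cv ∧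
          (surgeryGraph Γ v k).qExponent l = E) := fun h' => hl ⟨h'.1.1, h'.2⟩
      simp [hl, h2]
  have hright : laplaceCoeff σ p r ε b b' (Γ.knotCoeff v (fun _ => σ) n m) E =
      ∑ᶠ x ∈ S, surgeryTerm Γ v σ x := by
    have hmaps : Set.MapsTo (fun x : SurgeryIndex V =>
        ((x.1, x.2.1, x.2.2.1.1 ⬝ᵥ (Γ.B *ᵥ x.2.2.1.2), x.2.2.2) : ℤ × ℤ × ℤ × (ℕ ⊕ ℕ))) S
        {y | laplaceAdmissible σ p r ε b b' y.1 y.2.1 y.2.2.2 ∧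
          laplaceExponent σ p r ε y.1 y.2.1 y.2.2.1 y.2.2.2 = E} := by
      rintro x ⟨h1, h2, h3⟩
      refine ⟨(D.surgeryPair_mem_latticePairs_iff hambient hneg hb hb' h1.2.2).1 h2, ?_⟩
      rw [← h3, D.qExponent_surgeryPair hneg]
    rw [← finsum_mem_fiberwise _ _ hSfin hmaps, laplaceCoeff]
    refine finsum_congr fun y => ?_
    obtain ⟨α, β, γ, s⟩ := y
    by_cases hy : laplaceAdmissible σ p r ε b b' α β s ∧ laplaceExponent σ p r ε α β γ s = E
    · have h1 : (σ : ℤ) * Γ.knotCoeff v (fun _ => σ) n m α β γ =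
          ∑ᶠ x ∈ {x | x ∈ S ∧ ((x.1, x.2.1, x.2.2.1.1 ⬝ᵥ (Γ.B *ᵥ x.2.2.1.2), x.2.2.2) :
            ℤ × ℤ × ℤ × (ℕ ⊕ ℕ)) = (α, β, γ, s)}, surgeryTerm Γ v σ x := by
        have hs : ShiftAdmissible σ s := ((laplaceAdmissible_iff _ _ _ _ _ _ _ _ _).1 hy.1).1
        have h2 : Γ.knotCoeff v (fun _ => σ) n m α β γ =
            ∑ᶠ x ∈ {x : (V → ℤ) × (V → ℤ) | x.1 v = n ∧ x.2 v = m ∧ x.1 ⬝ᵥ (Γ.B *ᵥ x.2) = γ},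
              Γ.knotTerm v (fun _ => σ) α β x := by
          rw [knotCoeff]
          refine finsum_mem_inter_support_eq _ _ _ ?_
          ext x
          simp only [knotSupport, Set.mem_inter_iff, Set.mem_ofPred_eq, Function.mem_support]
          tauto
        rw [h2, mul_finsum_mem]
        refine finsum_mem_eq_of_bijOn (fun x => (α, β, x, s)) ⟨?_, ?_, ?_⟩ fun _ _ => rfl
        · rintro x ⟨hx1, hx2, hx3⟩
          refine ⟨⟨⟨hx1, hx2, hs⟩, ?_, ?_⟩, ?_⟩
          · exact (D.surgeryPair_mem_latticePairs_iff hambient hneg hb hb' hs).2 hy.1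
          · rw [D.qExponent_surgeryPair hneg]
            simp only [hx3]
            exact hy.2
          · simp only [hx3]
        · intro x _ x' _ hxx
          exact congrArg (fun x : SurgeryIndex V => x.2.2.1) hxx
        · rintro ⟨α', β', x, s'⟩ ⟨hx, heq⟩
          simp only [Prod.mk.injEq] at heq
          obtain ⟨rfl, rfl, h3, rfl⟩ := heq
          exact ⟨x, ⟨hx.1.1, hx.1.2.1, h3⟩, rfl⟩
      have hy' : ((α, β, γ, s) : ℤ × ℤ × ℤ × (ℕ ⊕ ℕ)) ∈
          {y : ℤ × ℤ × ℤ × (ℕ ⊕ ℕ) | laplaceAdmissible σ p r ε b b' y.1 y.2.1 y.2.2.2 ∧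
            laplaceExponent σ p r ε y.1 y.2.1 y.2.2.1 y.2.2.2 = E} := hy
      classical
      rw [finsum_eq_if, finsum_eq_if, if_pos hy', ← h1]
      split_ifs with h0
      · rfl
      · by_contra h2
        exact h0 ⟨⟨right_ne_zero_of_mul (Ne.symm h2), hy.1⟩, hy.2⟩
    · have h2 : ¬ (((α, β, γ, s) : ℤ × ℤ × ℤ × (ℕ ⊕ ℕ)) ∈
          laplaceSupport σ p r ε b b' (Γ.knotCoeff v (fun _ => σ) n m) ∧
          laplaceExponent σ p r ε α β γ s = E) := fun h' => hy ⟨h'.1.2, h'.2⟩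
      simp [hy, h2]
  rw [hleft, hright]

end SurgeryData

end

theorem theorem6p1 {V : Type*} [Fintype V] [DecidableEq V]
    (Γ : PlumbingGraph V) (v : V)
    (hΓ : Γ.graph.IsTree)
    (hambient : IsUnit (Γ.ambientB v).det)
    (hframing : Γ.B.det = 0)
    (p r : ℤ) (hp : p ≠ 0) (hr : r ≠ 0) (hpr : IsCoprime p r)
    {ℓ : ℕ} (k : Fin (ℓ + 1) → ℤ)
    (hk : contFrac (List.ofFn k) = (p : ℚ) / (r : ℚ))
    (hneg : (surgeryGraph Γ v k).IsNegDef) :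
    -- the good chambers of `Y_{p/r}` are `α₊ = (1, …, 1)` and `α₋ = (-1, …, -1)`
    (∀ σ : ℤˣ, (surgeryGraph Γ v k).IsGoodChamber fun _ => σ) ∧
    (∀ α, (surgeryGraph Γ v k).IsGoodChamber α →
      ∃ σ : ℤˣ, ∀ w, (surgeryGraph Γ v k).deg w ≠ 2 → α w = σ) ∧
    -- the labels identify `H₁(Y_{p/r})` with `ℤ / p`
    (∀ x, ∃ a : ℤ, IsLabel Γ v k p x a) ∧
    (∀ a : ℤ, ∃ x, IsLabel Γ v k p x a) ∧
    (∀ x x' (a a' : ℤ), IsLabel Γ v k p x a → IsLabel Γ v k p x' a' →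
      (p ∣ a - a' ↔ ∃ n, x - x' = (surgeryGraph Γ v k).B *ᵥ n)) ∧
    ∀ (σ : ℤˣ) (n m : ℤ),
      -- every coefficient of a monomial in `y, z` in `F_K` is a finite sum
      (∀ i j : ℤ, (Γ.knotSupport v (fun _ => σ) n m i j).Finite) ∧
      ∀ (bv cv : V ⊕ {i : Fin (ℓ + 1) // i ≠ 0} → ℤ) (b c : ℤ),
        IsLabel Γ v k p bv b → IsLabel Γ v k p cv c →
        -- both sides are well defined series in `q`, up to the constant term if `p ∣ b` or `p ∣ c`
        (∀ E : ℚ, {l | l ∈ (surgeryGraph Γ v k).zhatSupport (fun _ => σ) bv cv ∧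
            (surgeryGraph Γ v k).qExponent l ≤ E ∧
            ((surgeryGraph Γ v k).qExponent l ≠ 0 ∨ (¬ p ∣ b ∧ ¬ p ∣ c))}.Finite) ∧
        (∀ E : ℚ, {x : ℤ × ℤ × ℤ × (ℕ ⊕ ℕ) |
            x ∈ laplaceSupport σ p r (surgerySign p k) b c (Γ.knotCoeff v (fun _ => σ) n m) ∧
            laplaceExponent σ p r (surgerySign p k) x.1 x.2.1 x.2.2.1 x.2.2.2 ≤ E ∧
            (laplaceExponent σ p r (surgerySign p k) x.1 x.2.1 x.2.2.1 x.2.2.2 ≠ 0 ∨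
              (¬ p ∣ b ∧ ¬ p ∣ c))}.Finite) ∧
        -- the surgery formula
        (∀ e : ℚ, (e ≠ 0 ∨ (¬ p ∣ b ∧ ¬ p ∣ c)) →
          (surgeryGraph Γ v k).zhatCoeff (fun _ => σ) bv cv e =
            (((-1 : ℤˣ) ^ surgeryTau Γ v k : ℤˣ) : ℤ) *
              laplaceCoeff σ p r (surgerySign p k) b c (Γ.knotCoeff v (fun _ => σ) n m) e) := by
  obtain ⟨e, h, c, ε, D⟩ := exists_surgeryData hΓ hambient hframing hr hpr hk hneg
  have hc := surgeryGraph_preconnected (v := v) hΓ k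
  have hε := D.surgerySign_eq hneg
  refine ⟨isGoodChamber_const hneg hc, fun α hα => exists_eq_of_isGoodChamber hΓ hneg hα,
    fun x => ⟨_, (D.isLabel_iff hneg x _).2 rfl⟩, fun a => ?_, fun x x' a a' ha ha' => ?_,
    fun σ n m => ⟨D.finite_knotSupport hambient σ n m, fun bv cv b b' hb hb' => ?_⟩⟩
  · refine ⟨Pi.single (lastVertex v ℓ) (ε * a), (D.isLabel_iff hneg _ _).2 ?_⟩
    rw [dotProduct_single, D.last_eq, one_mul, ← mul_assoc, units_mul_self, one_mul]
  · rw [D.exists_mulVec_iff hambient, (D.isLabel_iff hneg x a).1 ha,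
      (D.isLabel_iff hneg x' a').1 ha', ← mul_sub, ← dotProduct_sub]
    exact Units.dvd_mul_left
  rw [hε]
  -- the exponent vanishes only for trivial labels, so the exceptional case may be ignored
  have hne : ∀ l, PlumbingGraph.InCone σ l →
      l ∈ (surgeryGraph Γ v k).latticePairs bv cv →
      ((surgeryGraph Γ v k).qExponent l ≠ 0 ∨ (¬ p ∣ b ∧ ¬ p ∣ b')) →
      (surgeryGraph Γ v k).qExponent l ≠ 0 := fun l hl hmem h0 =>
    h0.elim id fun hpb => D.qExponent_ne_zero_of_label hΓ hneg hb hb' hpb.1 hpb.2 hl hmem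
  refine ⟨fun E => ?_, fun E => ?_, fun E hE => ?_⟩
  · refine (hneg.finite_qExponent_le hc σ E).subset ?_
    rintro l ⟨⟨hmem, hT⟩, hle, h0⟩
    have hcone : PlumbingGraph.InCone σ l := fun w => by
      have h1 := edgeCoeff_sign (Finset.prod_ne_zero_iff.1 (right_ne_zero_of_mul hT) w
        (Finset.mem_univ w))
      constructor <;> linarith [h1.1, h1.2]
    exact ⟨hcone, hle, hne l hcone hmem h0⟩
  · refine ((finite_surgeryIndices (v := v) hΓ hambient hneg σ n m E).image fun x =>
      ((x.1, x.2.1, x.2.2.1.1 ⬝ᵥ (Γ.B *ᵥ x.2.2.1.2), x.2.2.2) : ℤ × ℤ × ℤ × (ℕ ⊕ ℕ))).subset ?_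
    rintro ⟨α, β, γ, s⟩ ⟨⟨hF, hadm⟩, hle, h0⟩
    obtain ⟨x, ⟨⟨hx1, hx2, hT⟩, hγ⟩, -⟩ := exists_ne_zero_of_finsum_mem_ne_zero hF
    have hs : ShiftAdmissible σ s := ((laplaceAdmissible_iff _ _ _ _ _ _ _ _ _).1 hadm).1
    have hT' : surgeryTerm Γ v σ (α, β, x, s) ≠ 0 := mul_ne_zero σ.ne_zero hT
    have hexp := D.qExponent_surgeryPair hneg σ (α, β, x, s)
    simp only [hγ] at hexp
    have hmem := (D.surgeryPair_mem_latticePairs_iff hambient hneg hb hb'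
      (x := (α, β, x, s)) hs).2 hadm
    refine ⟨(α, β, x, s), ⟨⟨hx1, hx2, hs⟩, hT', hexp ▸ hle, ?_⟩, by simp only [hγ]⟩
    exact hne _ (inCone_surgeryPair hT') hmem (hexp ▸ h0)
  · rw [D.surgeryTau_eq hneg, zpow_zero, Units.val_one, one_mul]
    refine D.zhatCoeff_eq_laplaceCoeff hambient hneg hb hb' σ n m E ?_
    refine (finite_surgeryIndices (v := v) hΓ hambient hneg σ n m E).subset ?_
    rintro x ⟨hx, hT, hmem, hEx⟩
    exact ⟨hx, hT, hEx.le, hne _ (inCone_surgeryPair hT) hmem (hEx.symm ▸ hE)⟩
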